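/- Let $B>0$. Call a measurable function $v:\mathbb R\to\mathbb R$ admissible if $v_+\in L^2_{\mathrm{loc}}(\mathbb R)$ and $v_-\in L^2(\mathbb R)+L^\infty(\mathbb R)$, where $v_\pm(x):=\max(\pm v(x),0)$. For admissible $v$ and $p\in\mathbb R$ let $$h_v(p)=-\frac{\mathrm d^2}{\mathrm dx^2}+(p+Bx)^2+v(x)$$ be the Schrödinger operator on $L^2(\mathbb R)$ whose domain consists of all $\psi\in L^2(\mathbb R)$ for which $-\psi''+(p+Bx)^2\psi+v\psi$, understood in the sense of distributions, belongs to $L^2(\mathbb R)$. Its eigenvalues form a strictly increasing sequence $\epsilon_0(p,v)<\epsilon_1(p,v)<\epsilon_2(p,v)<\cdots$. If $v_1$ and $v_2$ are admissible and $v_1(x)\le v_2(x)$ holds for a.e. $x\in\mathbb R$, then $$\epsilon_n(p,v_1)\le\epsilon_n(p,v_2)\qquad\text{for all }p\in\mathbb R,\ n\in\mathbb N_0 .$$ In particular, for an admissible $v$ and all $p\in\mathbb R$, $n\in\mathbb N_0$: if $v\ge 0$ a.e., then $\epsilon_n(p,v)\ge B(2n+1)$; if $v\le 0$ a.e., then $\epsilon_n(p,v)\le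 B(2n+1)$. -/

import Mathlib

open MeasureTheory

noncomputable section

namespace LandauPotential

/-- Admissible potentials: `v₊ = max v 0` is in `L²_loc(ℝ)` and `v₋ = max (-v) 0` is in
`(L² + L^∞)(ℝ)`. -/
structure Admissible (v : ℝ → ℝ) : Prop where
  posPart_locL2 : ∀ K : Set ℝ, IsCompact K → MemLp (fun x => max (v x) 0) 2 (volume.restrict K)
  negPart_L2_add_Linfty : ∃ f g : ℝ → ℝ, MemLp f 2 volume ∧ MemLp g ⊤ volume ∧
    (fun x => max (-v x) 0) =ᵐ[volume] f + g

/-- The differential expression `-f'' + (p + B x)² f + v f`. -/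
def fiberExpr (B p : ℝ) (v : ℝ → ℝ) (f : ℝ → ℂ) (x : ℝ) : ℂ :=
  -deriv (deriv f) x + (((p + B * x) ^ 2 + v x : ℝ) : ℂ) * f x

/-- The fiber operator `h_v(p) = -d²/dx² + (p + B x)² + v(x)` on `L²(ℝ)`, given by its graph:
`IsFiberImage B p v ψ φ` says that `ψ` is in the domain of `h_v(p)` and `h_v(p) ψ = φ`.
The domain consists of all `ψ ∈ L²(ℝ)` such that the distribution
`-ψ'' + (p + B x)² ψ + v ψ` belongs to `L²(ℝ)`, and `h_v(p) ψ` is that distribution.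
In other words, `h_v(p)` is the adjoint of its restriction to `C_c^∞(ℝ)`. -/
def IsFiberImage (B p : ℝ) (v : ℝ → ℝ) (ψ φ : Lp ℂ 2 (volume : Measure ℝ)) : Prop :=
  ∀ f : ℝ → ℂ, ContDiff ℝ (⊤ : ℕ∞) f → HasCompactSupport f →
    ∫ x, ψ x * fiberExpr B p v f x = ∫ x, φ x * f x

/-- The set of eigenvalues of `h_v(p)`: those `E` for which `h_v(p) ψ = E ψ` for some nonzero `ψ`
in the domain of `h_v(p)`. -/
def eigenvalues (B p : ℝ) (v : ℝ → ℝ) : Set ℝ :=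
  {E : ℝ | ∃ ψ : Lp ℂ 2 (volume : Measure ℝ), ψ ≠ 0 ∧ IsFiberImage B p v ψ ((E : ℂ) • ψ)}

/-- The eigenvalue `ε_n(p, v)`, `n = 0, 1, 2, …`, of `h_v(p)`, counted from below: the smallest
eigenvalue that has at least `n` eigenvalues strictly below it. -/
def eps (B p : ℝ) (v : ℝ → ℝ) (n : ℕ) : ℝ :=
  sInf {E : ℝ | E ∈ eigenvalues B p v ∧
    (n : ℕ∞) ≤ Set.encard {F : ℝ | F ∈ eigenvalues B p v ∧ F < E}}

end LandauPotential

end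

/-! The comparison is the min-max principle for quadratic forms. It must be arranged so that
eigenvalues of the distributionally defined operator are eigenvalues of a form, and so that two
ordered potentials give comparable forms.

Form. Write `v₋ = f + g` with `f` in L² and `g` bounded. `exists_isPrim_bounded` supplies a bounded
`s` with `s' = f - b s`, where `|b| ≤ 1`. Since `∫ (u' + s u)² = ∫ u'² + ∫ (s² - s') u²`, the
singular part `-f` of the potential is absorbed in a perfect square. After adding a constant `k` the
form becomes `∫ (u' + s u)² + ∫ m u²` with a weight `m ≥ (p + B x)² + 1`. If `v₁ ≤ v₂`, the same `s`
and `k` serve both potentials, and only the weight grows (`exists_represents`).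

Spectrum. With this form as squared norm, the form domain embeds compactly in L²
(`isCompactOperator_J`), because the weight grows at infinity. The eigenvalues are the reciprocals
of those of `J* J`, so only finitely many lie below any bound. They are simple, since the Wronskian
of two L² solutions is constant and integrable, hence zero. Simplicity makes the number of
eigenvalues below `a` equal to the number of independent eigenvectors, so a dimension count gives
`ncard_formSpectrum_le`: the smaller form has at least as many eigenvalues below `a`. Comparing
counts for every `a` compares the ordered eigenvalues (`enumBelow_le_enumBelow`).

Identification. A distributional eigenfunction is the limit of no approximation here: two
integrations show that it solves a first order system (`Represents.exists_isSol`), and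
`IsSol.energy_le` shows that an L² solution automatically has finite energy. Thus no eigenfunction
of the maximal operator escapes the form domain, and `Represents.eigenvalues_eq` follows.

Sign-definite potentials are compared with `v = 0`, whose eigenvalues `B (2 n + 1)` come from the
ladder operators (`eigenvalues_zero`). -/

open MeasureTheory

noncomputable section

namespace LandauPotential

/-! ### Enumerating an infinite set of reals that has finitely many elements below each bound. -/

section Enumeration

/-- The `n`-th element (from below) of a set of reals. -/
def enumBelow (S : Set ℝ) (n : ℕ) : ℝ :=
  sInf {E : ℝ | E ∈ S ∧ (n : ℕ∞) ≤ Set.encard {F : ℝ | F ∈ S ∧ F < E}}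

variable {S : Set ℝ}

lemma exists_isLeast_of_finite_Iic (hfin : ∀ a, (S ∩ Set.Iic a).Finite)
    {A : Set ℝ} (hA : A ⊆ S) (hne : A.Nonempty) :
    ∃ e, IsLeast A e := by
  obtain ⟨a, ha⟩ := hne
  have hf : (A ∩ Set.Iic a).Finite := (hfin a).subset (Set.inter_subset_inter_left _ hA)
  obtain ⟨e, he, hmin⟩ := Set.exists_min_image _ id hf ⟨a, ha, le_refl a⟩
  refine ⟨e, he.1, fun b hb => ?_⟩
  rcases le_total b a with h | h
  · exact hmin b ⟨hb, h⟩
  · exact he.2.trans h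

lemma exists_le_encard_below (hfin : ∀ a, (S ∩ Set.Iic a).Finite) (hinf : S.Infinite) (n : ℕ) :
    ∃ E ∈ S, (n : ℕ∞) ≤ Set.encard {F : ℝ | F ∈ S ∧ F < E} := by
  obtain ⟨t, htS, htc⟩ := hinf.exists_subset_card_eq n
  rcases t.eq_empty_or_nonempty with h0 | h0
  · obtain ⟨E, hE⟩ := hinf.nonempty
    subst h0
    exact ⟨E, hE, by simp [← htc]⟩
  · have : (S \ (S ∩ Set.Iic (t.max' h0))).Nonempty := (hinf.sdiff (hfin _)).nonempty
    obtain ⟨E, hE, hE2⟩ := this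
    have hlt : t.max' h0 < E := by
      by_contra h
      exact hE2 ⟨hE, not_lt.1 h⟩
    refine ⟨E, hE, ?_⟩
    rw [← htc, ← Set.encard_coe_eq_coe_finsetCard]
    exact Set.encard_le_encard fun x hx => ⟨htS hx, (t.le_max' x hx).trans_lt hlt⟩

lemma isLeast_enumBelow (hfin : ∀ a, (S ∩ Set.Iic a).Finite) (hinf : S.Infinite) (n : ℕ) :
    IsLeast {E : ℝ | E ∈ S ∧ (n : ℕ∞) ≤ Set.encard {F : ℝ | F ∈ S ∧ F < E}} (enumBelow S n) := by
  obtain ⟨E, hE⟩ := exists_le_encard_below hfin hinf n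
  obtain ⟨e, he⟩ := exists_isLeast_of_finite_Iic hfin
    (A := {E : ℝ | E ∈ S ∧ (n : ℕ∞) ≤ Set.encard {F : ℝ | F ∈ S ∧ F < E}}) (fun _ h => h.1) ⟨E, hE⟩
  have : enumBelow S n = e := he.csInf_eq
  rwa [this]

lemma finite_below (hfin : ∀ a, (S ∩ Set.Iic a).Finite)
    (E : ℝ) : {F : ℝ | F ∈ S ∧ F < E}.Finite :=
  (hfin E).subset fun _ h => ⟨h.1, h.2.le⟩

/-- Exactly `n` elements of `S` lie strictly below its `n`-th element. -/
lemma encard_below_enumBelow (hfin : ∀ a, (S ∩ Set.Iic a).Finite) (hinf : S.Infinite) (n : ℕ) :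
    Set.encard {F : ℝ | F ∈ S ∧ F < enumBelow S n} = n := by
  refine le_antisymm ?_ (isLeast_enumBelow hfin hinf n).1.2
  by_contra h
  push Not at h
  have hf := finite_below hfin (enumBelow S n)
  have hne : {F : ℝ | F ∈ S ∧ F < enumBelow S n}.Nonempty := by
    rw [← Set.encard_pos]
    exact lt_of_le_of_lt zero_le h
  -- If more than `n` elements lay below, the largest of them, `F`, would still have `n` elements
  -- below it, against minimality.
  obtain ⟨F, hF, hmax⟩ := Set.exists_max_image _ id hf hne
  have hsub : {F : ℝ | F ∈ S ∧ F < enumBelow S n} ⊆ insert F {G : ℝ | G ∈ S ∧ G < F} := by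
    intro G hG
    rcases (hmax G hG).lt_or_eq with h1 | h1
    · exact Or.inr ⟨hG.1, h1⟩
    · exact Or.inl h1
  have h2 := (Set.encard_le_encard hsub).trans (Set.encard_insert_le _ _)
  have h3 : (n : ℕ∞) ≤ Set.encard {G : ℝ | G ∈ S ∧ G < F} := by
    have := Order.add_one_le_of_lt h
    have h4 := this.trans h2
    exact (ENat.add_le_add_iff_right (by simp)).1 h4
  exact absurd ((isLeast_enumBelow hfin hinf n).2 ⟨hF.1, h3⟩) (not_le.2 hF.2)

lemma strictMono_enumBelow (hfin : ∀ a, (S ∩ Set.Iic a).Finite) (hinf : S.Infinite) :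
    StrictMono (enumBelow S) := by
  refine strictMono_nat_of_lt_succ fun n => ?_
  refine lt_of_le_of_ne ?_ fun h => ?_
  · have h1 := (isLeast_enumBelow hfin hinf (n + 1)).1
    exact (isLeast_enumBelow hfin hinf n).2
      ⟨h1.1, le_trans (by exact_mod_cast Nat.le_succ n) h1.2⟩
  · have h1 := encard_below_enumBelow hfin hinf n
    have h2 := encard_below_enumBelow hfin hinf (n + 1)
    rw [← h, h1] at h2
    have : n = n + 1 := by exact_mod_cast h2
    omega

lemma range_enumBelow (hfin : ∀ a, (S ∩ Set.Iic a).Finite) (hinf : S.Infinite) :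
    Set.range (enumBelow S) = S := by
  refine Set.Subset.antisymm ?_ fun E hE => ?_
  · rintro _ ⟨n, rfl⟩
    exact (isLeast_enumBelow hfin hinf n).1.1
  · have hf := finite_below hfin E
    obtain ⟨n, hn⟩ : ∃ n : ℕ, Set.encard {F : ℝ | F ∈ S ∧ F < E} = n :=
      ⟨_, hf.encard_eq_coe⟩
    refine ⟨n, le_antisymm ((isLeast_enumBelow hfin hinf n).2 ⟨hE, hn.ge⟩) ?_⟩
    by_contra h
    push Not at h
    have hsub : insert (enumBelow S n) {F : ℝ | F ∈ S ∧ F < enumBelow S n} ⊆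
        {F : ℝ | F ∈ S ∧ F < E} := by
      rintro G (rfl | hG)
      · exact ⟨(isLeast_enumBelow hfin hinf n).1.1, h⟩
      · exact ⟨hG.1, hG.2.trans h⟩
    have h1 := Set.encard_le_encard hsub
    rw [Set.encard_insert_of_notMem (fun h => lt_irrefl _ h.2),
      encard_below_enumBelow hfin hinf n, hn] at h1
    have : n + 1 ≤ n := by exact_mod_cast h1
    omega

/-- If `S₁` has at least as many elements as `S₂` below every bound, its `n`-th element is at most
that of `S₂`. -/
lemma enumBelow_le_enumBelow {S₁ S₂ : Set ℝ} (hfin₁ : ∀ a, (S₁ ∩ Set.Iic a).Finite)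
    (hinf₁ : S₁.Infinite) (hfin₂ : ∀ a, (S₂ ∩ Set.Iic a).Finite) (hinf₂ : S₂.Infinite)
    (h : ∀ a, (S₂ ∩ Set.Iic a).ncard ≤ (S₁ ∩ Set.Iic a).ncard) (n : ℕ) :
    enumBelow S₁ n ≤ enumBelow S₂ n := by
  set E := enumBelow S₂ n with hE
  by_contra hlt
  push Not at hlt
  -- Up to `E` the set `S₂` has `n + 1` elements, while `S₁` would have at most `n`, contradicting
  -- the comparison of counts at `a = E`.
  have h1 : Set.encard (S₂ ∩ Set.Iic E) = n + 1 := by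
    have : S₂ ∩ Set.Iic E = insert E {F : ℝ | F ∈ S₂ ∧ F < E} := by
      ext F
      constructor
      · rintro ⟨hF, hFE⟩
        rcases (show F ≤ E from hFE).eq_or_lt with h | h
        · exact Or.inl h
        · exact Or.inr ⟨hF, h⟩
      · rintro (rfl | hF)
        · exact ⟨(isLeast_enumBelow hfin₂ hinf₂ n).1.1, Set.mem_Iic.2 le_rfl⟩
        · exact ⟨hF.1, hF.2.le⟩
    rw [this, Set.encard_insert_of_notMem (fun h => lt_irrefl _ h.2),
      encard_below_enumBelow hfin₂ hinf₂ n]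
  have h2 : Set.encard (S₁ ∩ Set.Iic E) ≤ n := by
    rw [← encard_below_enumBelow hfin₁ hinf₁ n]
    exact Set.encard_le_encard fun F hF => ⟨hF.1, lt_of_le_of_lt hF.2 hlt⟩
  have h3 := h E
  have h4 : ((S₂ ∩ Set.Iic E).ncard : ℕ∞) ≤ ((S₁ ∩ Set.Iic E).ncard : ℕ∞) := by exact_mod_cast h3
  rw [(hfin₁ E).cast_ncard_eq, (hfin₂ E).cast_ncard_eq, h1] at h4
  have : n + 1 ≤ n := by exact_mod_cast h4.trans h2
  omega

end Enumeration

/-! ### Abstract spectral theory of a compact form embedding, and the min-max comparison. -/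

section FormSpectrum

open scoped RealInnerProductSpace

variable {K H : Type*} [NormedAddCommGroup K] [InnerProductSpace ℝ K]
  [NormedAddCommGroup H] [InnerProductSpace ℝ H]

/-- `x` solves the generalized eigenvalue problem `⟪x, ·⟫ = l ⟪J x, J ·⟫`. -/
def IsFormEigenvector (J : K →L[ℝ] H) (l : ℝ) (x : K) : Prop :=
  x ≠ 0 ∧ ∀ y, ⟪x, y⟫ = l * ⟪J x, J y⟫

/-- The eigenvalues of the form `‖·‖²` relative to `‖J ·‖²`. -/
def formSpectrum (J : K →L[ℝ] H) : Set ℝ := {l | ∃ x, IsFormEigenvector J l x}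

/-- All generalized eigenvalues are simple. -/
def HasSimpleFormSpectrum (J : K →L[ℝ] H) : Prop :=
  ∀ l x y, IsFormEigenvector J l x → IsFormEigenvector J l y → ∃ c : ℝ, y = c • x

variable {J : K →L[ℝ] H} {l l' : ℝ} {x y : K}

lemma IsFormEigenvector.norm_sq (h : IsFormEigenvector J l x) : ‖x‖ ^ 2 = l * ‖J x‖ ^ 2 := by
  simpa only [real_inner_self_eq_norm_sq] using h.2 x

lemma IsFormEigenvector.pos (h : IsFormEigenvector J l x) : 0 < l := by
  have h1 := h.norm_sq
  have h2 : 0 < ‖x‖ ^ 2 := pow_pos (norm_pos_iff.2 h.1) 2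
  by_contra hl
  push Not at hl
  nlinarith [sq_nonneg ‖J x‖]

lemma IsFormEigenvector.inner_map_eq_zero (h : IsFormEigenvector J l x) (hxy : ⟪x, y⟫ = 0) :
    ⟪J x, J y⟫ = 0 := by
  have := h.2 y
  rw [hxy] at this
  exact (mul_eq_zero.1 this.symm).resolve_left h.pos.ne'

/-- The usual symmetry argument: computing `⟪x, y⟫` from either eigenvector gives `(l - l') ⟪J x, J
y⟫ = 0`. -/
lemma IsFormEigenvector.inner_eq_zero (h : IsFormEigenvector J l x)
    (h' : IsFormEigenvector J l' y) (hl : l ≠ l') : ⟪x, y⟫ = 0 := by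
  have h1 := h.2 y
  have h2 := h'.2 x
  rw [real_inner_comm, real_inner_comm (J x)] at h2
  have h3 : (l - l') * ⟪J x, J y⟫ = 0 := by linarith
  rw [h1, (mul_eq_zero.1 h3).resolve_left (sub_ne_zero.2 hl), mul_zero]

/-- A compact form has finitely many eigenvalues below any bound. -/
lemma finite_formSpectrum_inter_Iic (hJ : IsCompactOperator J) (a : ℝ) :
    (formSpectrum J ∩ Set.Iic a).Finite := by
  by_contra hinf
  have hinf' : (formSpectrum J ∩ Set.Iic a).Infinite := hinf
  let l : ℕ → ℝ := fun n => (hinf'.natEmbedding _ n : ℝ)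
  have hlinj : Function.Injective l := fun i j hij =>
    (hinf'.natEmbedding _).injective (Subtype.ext hij)
  have hl : ∀ n, l n ∈ formSpectrum J ∩ Set.Iic a := fun n => (hinf'.natEmbedding _ n).2
  choose x hx using fun n => (hl n).1
  let e : ℕ → K := fun n => ‖x n‖⁻¹ • x n
  have hxn : ∀ n, 0 < ‖x n‖ := fun n => norm_pos_iff.2 (hx n).1
  have he1 : ∀ n, ‖e n‖ = 1 := fun n => by
    simp only [e, norm_smul, norm_inv, norm_norm]
    exact inv_mul_cancel₀ (hxn n).ne'
  have he : ∀ n, IsFormEigenvector J (l n) (e n) := fun n => by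
    refine ⟨fun h => ?_, fun y => ?_⟩
    · have := he1 n
      rw [h, norm_zero] at this
      exact zero_ne_one this
    · simp only [e, inner_smul_left, map_smul, (hx n).2 y]
      simp only [conj_trivial]
      ring
  have hapos : 0 < a := (hx 0).pos.trans_le (hl 0).2
  have hJe : ∀ n, a⁻¹ ≤ ‖J (e n)‖ ^ 2 := fun n => by
    have h1 := (he n).norm_sq
    rw [he1, one_pow] at h1
    have h2 : l n * ‖J (e n)‖ ^ 2 ≤ a * ‖J (e n)‖ ^ 2 :=
      mul_le_mul_of_nonneg_right (hl n).2 (sq_nonneg _)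
    rw [inv_le_iff_one_le_mul₀' hapos]
    linarith
  -- The images of unit eigenvectors are orthogonal and have squared norm `1 / l n ≥ 1 / a`, so they
  -- stay uniformly apart and have no Cauchy subsequence.
  have hsep : ∀ i j, i ≠ j → a⁻¹ ≤ ‖J (e i) - J (e j)‖ ^ 2 := fun i j hij => by
    have h0 : ⟪J (e i), J (e j)⟫ = 0 :=
      (he i).inner_map_eq_zero ((he i).inner_eq_zero (he j) fun h => hij (hlinj h))
    rw [norm_sub_sq_real, h0]
    have := hJe i
    nlinarith [sq_nonneg ‖J (e j)‖]
  obtain ⟨C, hC, hsub⟩ := hJ.image_closedBall_subset_compact (f := (J : K →ₗ[ℝ] H)) 1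
  have hmem : ∀ n, J (e n) ∈ C := fun n => hsub ⟨e n, by simp [he1], rfl⟩
  obtain ⟨b, -, φ, hφ, hlim⟩ := hC.tendsto_subseq hmem
  have hcau := hlim.cauchySeq
  rw [Metric.cauchySeq_iff] at hcau
  obtain ⟨N, hN⟩ := hcau (Real.sqrt a⁻¹) (Real.sqrt_pos.2 (inv_pos.2 hapos))
  have h1 := hN N le_rfl (N + 1) (Nat.le_succ N)
  rw [dist_eq_norm] at h1
  have h2 := hsep (φ N) (φ (N + 1)) (hφ.injective.ne (Nat.succ_ne_self N).symm)
  have h3 := Real.lt_sqrt (norm_nonneg _) |>.1 h1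
  exact absurd h2 (not_le.2 h3)

variable [CompleteSpace K] [CompleteSpace H]

/-- A nonzero vector orthogonal to a family of eigenvectors bounds the lowest eigenvalue on the
orthogonal complement of that family. -/
lemma exists_isFormEigenvector_orthogonal (hJ : IsCompactOperator J) (X : Set K)
    (hX : ∀ e ∈ X, ∃ l, IsFormEigenvector J l e) (w : K) (hw0 : w ≠ 0)
    (hw : ∀ e ∈ X, ⟪e, w⟫ = 0) (L : ℝ) (h : ‖w‖ ^ 2 ≤ L * ‖J w‖ ^ 2) :
    ∃ l ≤ L, ∃ x, IsFormEigenvector J l x ∧ ∀ e ∈ X, ⟪e, x⟫ = 0 := by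
  set M : Submodule ℝ K := (Submodule.span ℝ X)ᗮ with hM
  have memM : ∀ z : K, z ∈ M ↔ ∀ e ∈ X, ⟪e, z⟫ = 0 := by
    intro z
    rw [hM, Submodule.mem_orthogonal]
    refine ⟨fun hz e he => hz e (Submodule.subset_span he), fun hz u hu => ?_⟩
    induction hu using Submodule.span_induction with
    | mem x hx => exact hz x hx
    | zero => simp
    | add x y _ _ hx hy => rw [inner_add_left, hx, hy, add_zero]
    | smul a x _ hx => rw [inner_smul_left, hx, mul_zero]
  -- `⟪x, ·⟫ = l ⟪J x, J ·⟫` says `T x = l⁻¹ x`, so the lowest form eigenvalue on `M` is the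
  -- reciprocal of the top eigenvalue of `T` on `M`.
  set T : K →L[ℝ] K := (ContinuousLinearMap.adjoint J).comp J with hT
  have hTi : ∀ a b, ⟪T a, b⟫ = ⟪J a, J b⟫ := fun a b => by
    rw [hT, ContinuousLinearMap.comp_apply, ContinuousLinearMap.adjoint_inner_left]
  have hTc : IsCompactOperator T := hJ.clm_comp (ContinuousLinearMap.adjoint J)
  have hTs : T.IsSymmetric := fun a b => by
    change ⟪T a, b⟫ = ⟪a, T b⟫
    rw [hTi, real_inner_comm (T b), hTi, real_inner_comm]
  have hinv : ∀ v ∈ M, T v ∈ M := by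
    intro v hv
    rw [memM] at hv ⊢
    intro e he
    obtain ⟨l, hl⟩ := hX e he
    rw [real_inner_comm, hTi, real_inner_comm]
    exact hl.inner_map_eq_zero (hv e he)
  let S : M →L[ℝ] M := T.restrict hinv
  have hSc : IsCompactOperator S := hTc.restrict' hinv
  have hSs : S.IsSymmetric := hTs.restrict_invariant hinv
  have hSi : ∀ a : M, ⟪S a, a⟫ = ‖J a‖ ^ 2 := fun a => by
    rw [← real_inner_self_eq_norm_sq, ← hTi]
    rfl
  let w' : M := ⟨w, (memM w).2 hw⟩
  have hw' : w' ≠ 0 := fun h => hw0 (congrArg Subtype.val h)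
  have : Nontrivial M := ⟨⟨w', 0, hw'⟩⟩
  have hRnn : ∀ a : M, 0 ≤ S.rayleighQuotient a := fun a => by
    have : S.reApplyInnerSelf a = ‖J a‖ ^ 2 := hSi a
    rw [ContinuousLinearMap.rayleighQuotient, this]
    positivity
  have hwpos : 0 < ‖w‖ ^ 2 := pow_pos (norm_pos_iff.2 hw0) 2
  have hJw : 0 < ‖J w‖ ^ 2 := by
    rcases (sq_nonneg ‖J w‖).eq_or_lt with h0 | h0
    · rw [← h0, mul_zero] at h
      linarith
    · exact h0
  have hRw : ‖J w‖ ^ 2 / ‖w‖ ^ 2 ≤ ‖S‖ := by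
    refine le_trans (le_of_eq ?_) ((le_abs_self _).trans (S.rayleighQuotient_le_norm w'))
    have : S.reApplyInnerSelf w' = ‖J w‖ ^ 2 := hSi w'
    rw [ContinuousLinearMap.rayleighQuotient, this]
    rfl
  have hSpos : 0 < ‖S‖ := lt_of_lt_of_le (by positivity) hRw
  -- `‖S‖` is the supremum of the Rayleigh quotients, which are nonnegative; were it in the
  -- resolvent set, they would stay below `‖S‖ - ε`.
  have hspec : ‖S‖ ∈ spectrum ℝ S := by
    by_contra hcon
    obtain ⟨ε, hε, hR⟩ := S.rayleighQuotient_le_of_norm_mem_resolventSet (not_not.1 hcon)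
    have h1 := S.norm_eq_iSup_rayleighQuotient hSs
    have h2 : (⨆ x, |S.rayleighQuotient x|) ≤ ‖S‖ - ε :=
      ciSup_le fun a => by rw [abs_of_nonneg (hRnn a)]; exact hR a
    linarith
  rw [← hSc.hasEigenvalue_iff_mem_spectrum hSpos.ne'] at hspec
  obtain ⟨x, hx⟩ := hspec.exists_hasEigenvector
  have hx1 : S x = ‖S‖ • x := hx.apply_eq_smul
  have hx2 : T (x : K) = ‖S‖ • (x : K) := congrArg Subtype.val hx1
  refine ⟨‖S‖⁻¹, ?_, x, ⟨fun h => hx.2 (Subtype.ext h), fun y => ?_⟩, (memM x).1 x.2⟩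
  · have hL : ‖w‖ ^ 2 / ‖J w‖ ^ 2 ≤ L := (div_le_iff₀ hJw).2 h
    refine le_trans ?_ hL
    rw [inv_le_comm₀ hSpos (by positivity), inv_div]
    exact hRw
  · rw [← hTi, hx2, inner_smul_left]
    simp [hSpos.ne']

/-- A compact injective form with simple spectrum on an infinite-dimensional space has infinitely
many eigenvalues. -/
lemma infinite_formSpectrum (hJ : IsCompactOperator J) (hinj : Function.Injective J)
    (hs : HasSimpleFormSpectrum J) (hK : ¬ FiniteDimensional ℝ K) : (formSpectrum J).Infinite := by
  intro hf
  choose! e he using fun l (hl : l ∈ formSpectrum J) => hl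
  let X : Set K := e '' formSpectrum J
  have : FiniteDimensional ℝ (Submodule.span ℝ X) :=
    FiniteDimensional.span_of_finite ℝ (hf.image e)
  have hne : Submodule.span ℝ X ≠ ⊤ := fun h => hK <| by
    rw [h] at this
    exact Module.finite_def.2 (Submodule.fg_iff_finiteDimensional _ |>.2 this)
  have hbot : (Submodule.span ℝ X)ᗮ ≠ ⊥ := fun h =>
    hne ((Submodule.orthogonal_eq_bot_iff).1 h)
  obtain ⟨w, hw, hw0⟩ := (Submodule.ne_bot_iff _).1 hbot
  have hJw : J w ≠ 0 := fun h => hw0 (hinj (h.trans (map_zero J).symm))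
  have hJw' : 0 < ‖J w‖ ^ 2 := pow_pos (norm_pos_iff.2 hJw) 2
  -- The new eigenvector is orthogonal to one chosen representative per eigenvalue, yet by
  -- simplicity it is a multiple of one of them.
  obtain ⟨l, -, x, hx, hxo⟩ := exists_isFormEigenvector_orthogonal hJ X
    (by rintro _ ⟨l, hl, rfl⟩; exact ⟨l, he l hl⟩) w hw0
    (fun e he => (Submodule.mem_orthogonal _ _).1 hw e (Submodule.subset_span he))
    (‖w‖ ^ 2 / ‖J w‖ ^ 2) (by rw [div_mul_cancel₀ _ hJw'.ne'])
  have hl : l ∈ formSpectrum J := ⟨x, hx⟩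
  obtain ⟨c, hc⟩ := hs l _ _ (he l hl) hx
  have h1 := hxo (e l) ⟨l, hl, rfl⟩
  have h2 : ⟪x, x⟫ = 0 := by
    nth_rewrite 1 [hc]
    rw [inner_smul_left, h1, mul_zero]
  exact hx.1 (inner_self_eq_zero.1 h2)

variable {K' : Type*} [NormedAddCommGroup K'] [InnerProductSpace ℝ K']

/-- Min-max comparison of the eigenvalue counts of two forms. -/
lemma ncard_formSpectrum_le (hJ : IsCompactOperator J) (hs : HasSimpleFormSpectrum J)
    {J' : K' →L[ℝ] H} (hJ' : IsCompactOperator J') (i : K' →ₗ[ℝ] K) (hi : ∀ x, ‖i x‖ ≤ ‖x‖)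
    (hiJ : ∀ x, J (i x) = J' x) (a : ℝ) :
    (formSpectrum J' ∩ Set.Iic a).ncard ≤ (formSpectrum J ∩ Set.Iic a).ncard := by
  have hf := finite_formSpectrum_inter_Iic hJ a
  have hf' := finite_formSpectrum_inter_Iic hJ' a
  have := hf.fintype
  have := hf'.fintype
  by_contra hlt
  push Not at hlt
  choose! e he using fun l (hl : l ∈ formSpectrum J) => hl
  choose! e' he' using fun l (hl : l ∈ formSpectrum J') => hl
  let comb : ((formSpectrum J' ∩ Set.Iic a : Set ℝ) → ℝ) →ₗ[ℝ] K' :=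
    Fintype.linearCombination ℝ (fun l => e' l.1)
  let A : ((formSpectrum J' ∩ Set.Iic a : Set ℝ) → ℝ) →ₗ[ℝ]
      ((formSpectrum J ∩ Set.Iic a : Set ℝ) → ℝ) :=
    LinearMap.pi fun l => (innerSL ℝ (e l.1)).toLinearMap ∘ₗ i ∘ₗ comb
  -- There are more `J'`-eigenvectors below `a` than orthogonality conditions, so a nontrivial
  -- combination maps under `i` to the orthogonal complement of all chosen `J`-eigenvectors below
  -- `a`.
  obtain ⟨c, hc, hc0⟩ : ∃ c, A c = 0 ∧ c ≠ 0 := by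
    have hker : LinearMap.ker A ≠ ⊥ := LinearMap.ker_ne_bot_of_finrank_lt (by
      simpa [Module.finrank_fintype_fun_eq_card, ← Set.toFinset_card, ← Set.ncard_eq_toFinset_card']
        using hlt)
    obtain ⟨c, hc, hc0⟩ := (Submodule.ne_bot_iff _).1 hker
    exact ⟨c, hc, hc0⟩
  set w := comb c with hw
  have hwsum : w = ∑ l, c l • e' l.1 := rfl
  have horth : ∀ l l' : (formSpectrum J' ∩ Set.Iic a : Set ℝ), l ≠ l' → ⟪e' l.1, e' l'.1⟫ = 0 :=
    fun l l' hll => (he' l.1 l.2.1).inner_eq_zero (he' l'.1 l'.2.1) fun h => hll (Subtype.ext h)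
  have hnw : ‖w‖ ^ 2 = ∑ l, c l ^ 2 * ‖e' l.1‖ ^ 2 := by
    rw [← real_inner_self_eq_norm_sq, hwsum, sum_inner]
    refine Finset.sum_congr rfl fun l _ => ?_
    rw [inner_sum, Finset.sum_eq_single l]
    · rw [inner_smul_left, inner_smul_right, real_inner_self_eq_norm_sq, conj_trivial]
      ring
    · intro l' _ hl'
      rw [inner_smul_left, inner_smul_right, horth l l' hl'.symm]
      simp
    · simp
  have hnJw : ‖J' w‖ ^ 2 = ∑ l, c l ^ 2 * ‖J' (e' l.1)‖ ^ 2 := by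
    rw [← real_inner_self_eq_norm_sq, hwsum, map_sum, sum_inner]
    refine Finset.sum_congr rfl fun l _ => ?_
    rw [inner_sum, Finset.sum_eq_single l]
    · rw [map_smul, inner_smul_left, inner_smul_right, real_inner_self_eq_norm_sq, conj_trivial]
      ring
    · intro l' _ hl'
      rw [map_smul, map_smul, inner_smul_left, inner_smul_right,
        (he' l.1 l.2.1).inner_map_eq_zero (horth l l' hl'.symm)]
      simp
    · simp
  have hwpos : 0 < ‖w‖ ^ 2 := by
    obtain ⟨l, hl⟩ := Function.ne_iff.1 hc0
    rw [hnw]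
    refine Finset.sum_pos' (fun l _ => by positivity) ⟨l, Finset.mem_univ _, ?_⟩
    have h1 : c l ≠ 0 := hl
    have h2 : ‖e' l.1‖ ≠ 0 := norm_ne_zero_iff.2 (he' l.1 l.2.1).1
    positivity
  have hle : ‖w‖ ^ 2 ≤ a * ‖J' w‖ ^ 2 := by
    rw [hnw, hnJw, Finset.mul_sum]
    refine Finset.sum_le_sum fun l _ => ?_
    rw [(he' l.1 l.2.1).norm_sq]
    have h1 : l.1 ≤ a := l.2.2
    have h2 : 0 ≤ c l ^ 2 * ‖J' (e' l.1)‖ ^ 2 := by positivity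
    nlinarith
  have hiw0 : i w ≠ 0 := fun h => by
    have := hiJ w
    rw [h, map_zero] at this
    rw [← this, norm_zero] at hle
    simp only [ne_eq, OfNat.ofNat_ne_zero, not_false_eq_true, zero_pow, mul_zero] at hle
    linarith
  have hiw : ‖i w‖ ^ 2 ≤ a * ‖J (i w)‖ ^ 2 := by
    rw [hiJ]
    exact (pow_le_pow_left₀ (norm_nonneg _) (hi w) 2).trans hle
  -- The quotient of `i w` is at most `a`, which forces another `J`-eigenvalue `l ≤ a` with an
  -- eigenvector orthogonal to all those listed; simplicity excludes this.
  obtain ⟨l, hla, x, hx, hxo⟩ := exists_isFormEigenvector_orthogonal hJ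
    (e '' (formSpectrum J ∩ Set.Iic a))
    (by rintro _ ⟨l, hl, rfl⟩; exact ⟨l, he l hl.1⟩) (i w) hiw0
    (by
      rintro _ ⟨l, hl, rfl⟩
      exact congrFun hc ⟨l, hl⟩) a hiw
  have hl : l ∈ formSpectrum J := ⟨x, hx⟩
  obtain ⟨b, hb⟩ := hs l _ _ (he l hl) hx
  have h1 := hxo (e l) ⟨l, ⟨hl, hla⟩, rfl⟩
  have h2 : ⟪x, x⟫ = 0 := by
    nth_rewrite 1 [hb]
    rw [inner_smul_left, h1, mul_zero]
  exact hx.1 (inner_self_eq_zero.1 h2)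

end FormSpectrum

open Filter Topology

/-! ### Primitives of locally integrable functions, test functions and the du Bois-Reymond lemmas.
-/

section Primitive

lemma _root_.MeasureTheory.LocallyIntegrable.intervalIntegrable' {g : ℝ → ℝ}
    (hg : LocallyIntegrable g volume) (a b : ℝ) : IntervalIntegrable g volume a b :=
  (hg.integrableOn_isCompact isCompact_uIcc).intervalIntegrable

lemma _root_.MeasureTheory.LocallyIntegrable.congr_ae {f g : ℝ → ℝ}
    (hf : LocallyIntegrable f volume) (h : f =ᵐ[volume] g) : LocallyIntegrable g volume := by
  rw [locallyIntegrable_iff] at hf ⊢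
  exact fun k hk => (hf k hk).congr (ae_restrict_of_ae h)

/-- `u` is a primitive of the locally integrable function `g`. -/
def IsPrim (u g : ℝ → ℝ) : Prop :=
  LocallyIntegrable g volume ∧ ∀ a b, ∫ x in a..b, g x = u b - u a

namespace IsPrim

variable {u v g h : ℝ → ℝ}

lemma eq_add (hu : IsPrim u g) (a x : ℝ) : u x = u a + ∫ t in a..x, g t := by
  rw [hu.2]; ring

lemma continuous (hu : IsPrim u g) : Continuous u := by
  have : u = fun x => u 0 + ∫ t in (0 : ℝ)..x, g t := funext fun x => hu.eq_add 0 x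
  rw [this]
  exact continuous_const.add (intervalIntegral.continuous_primitive hu.1.intervalIntegrable' 0)

lemma primitive (hg : LocallyIntegrable g volume) (a : ℝ) :
    IsPrim (fun x => ∫ t in a..x, g t) g :=
  ⟨hg, fun b c => by
    rw [intervalIntegral.integral_interval_sub_left] <;> exact hg.intervalIntegrable' _ _⟩

lemma congr (hu : IsPrim u g) (h1 : ∀ x, u x = v x) (h2 : g =ᵐ[volume] h) : IsPrim v h := by
  obtain rfl : u = v := funext h1
  exact ⟨hu.1.congr_ae h2, fun a b => by
    rw [← hu.2, intervalIntegral.integral_congr_ae (h2.mono fun x hx _ => hx.symm)]⟩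

lemma of_hasDerivAt (h : ∀ x, HasDerivAt u (g x) x) (hg : Continuous g) : IsPrim u g :=
  ⟨hg.locallyIntegrable, fun a b =>
    intervalIntegral.integral_eq_sub_of_hasDerivAt (fun x _ => h x) (hg.intervalIntegrable a b)⟩

lemma hasDerivAt (hu : IsPrim u g) (hg : Continuous g) (x : ℝ) : HasDerivAt u (g x) x := by
  have : u = fun x => u 0 + ∫ t in (0 : ℝ)..x, g t := funext fun x => hu.eq_add 0 x
  rw [this]
  exact (intervalIntegral.integral_hasDerivAt_right (hg.intervalIntegrable 0 x)
    (hg.stronglyMeasurableAtFilter _ _) hg.continuousAt).const_add _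

lemma ae_hasDerivAt (hu : IsPrim u g) : ∀ᵐ x, HasDerivAt u (g x) x := by
  have : u = fun x => u 0 + ∫ t in (0 : ℝ)..x, g t := funext fun x => hu.eq_add 0 x
  rw [this]
  filter_upwards [LocallyIntegrable.ae_hasDerivAt_integral hu.1] with x hx
  exact (hx 0).const_add _

lemma absolutelyContinuousOnInterval (hu : IsPrim u g) (a b : ℝ) :
    AbsolutelyContinuousOnInterval u a b := by
  have : u = fun x => u a + ∫ t in a..x, g t := funext fun x => hu.eq_add a x
  rw [this]
  refine AbsolutelyContinuousOnInterval.add ?_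
    ((hu.1.intervalIntegrable' a b).absolutelyContinuousOnInterval_intervalIntegral (by simp))
  exact (LipschitzWith.const (u a)).lipschitzOnWith.absolutelyContinuousOnInterval

lemma const (c : ℝ) : IsPrim (fun _ => c) (fun _ => 0) :=
  ⟨locallyIntegrable_zero, fun a b => by simp⟩

lemma add (hu : IsPrim u g) (hv : IsPrim v h) :
    IsPrim (fun x => u x + v x) (fun x => g x + h x) :=
  ⟨hu.1.add hv.1, fun a b => by
    rw [intervalIntegral.integral_add (hu.1.intervalIntegrable' a b)
      (hv.1.intervalIntegrable' a b), hu.2, hv.2]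
    ring⟩

lemma const_mul (hu : IsPrim u g) (c : ℝ) : IsPrim (fun x => c * u x) (fun x => c * g x) :=
  ⟨hu.1.continuous_mul continuous_const, fun a b => by
    rw [intervalIntegral.integral_const_mul, hu.2]
    ring⟩

/-- Primitives are absolutely continuous and have the given derivatives almost everywhere, so the
product rule integrates. -/
lemma mul (hu : IsPrim u g) (hv : IsPrim v h) :
    IsPrim (fun x => u x * v x) (fun x => g x * v x + u x * h x) := by
  refine ⟨?_, fun a b => ?_⟩
  · refine LocallyIntegrable.add ?_ (hv.1.continuous_mul hu.continuous)
    simpa only [mul_comm] using hu.1.continuous_mul hv.continuous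
  · rw [← (hu.absolutelyContinuousOnInterval a b).integral_deriv_mul_eq_sub
      (hv.absolutelyContinuousOnInterval a b)]
    refine intervalIntegral.integral_congr_ae ?_
    filter_upwards [hu.ae_hasDerivAt, hv.ae_hasDerivAt] with x hx hx' _
    rw [hx.deriv, hx'.deriv]

lemma neg (hu : IsPrim u g) : IsPrim (fun x => -u x) (fun x => -g x) := by
  simpa using hu.const_mul (-1)

lemma sub (hu : IsPrim u g) (hv : IsPrim v h) :
    IsPrim (fun x => u x - v x) (fun x => g x - h x) := by
  simpa only [sub_eq_add_neg] using hu.add hv.neg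

/-- Integrability of `g` makes the limit exist; integrability of `u` on a set of infinite measure
makes it zero. -/
lemma tendsto_atTop (hu : IsPrim u g) (hui : Integrable u) (hg : Integrable g) :
    Tendsto u atTop (𝓝 0) := by
  have h1 : Tendsto u atTop (𝓝 (u 0 + ∫ t in Set.Ioi 0, g t)) := by
    refine Tendsto.congr (fun x => (hu.eq_add 0 x).symm) ?_
    exact tendsto_const_nhds.add
      (intervalIntegral_tendsto_integral_Ioi 0 hg.integrableOn tendsto_id)
  have h2 : u 0 + ∫ t in Set.Ioi 0, g t = 0 := by
    refine IntegrableAtFilter.eq_zero_of_tendsto (μ := volume)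
      (hui.integrableAtFilter atTop) (fun s hs => ?_) h1
    obtain ⟨b, hb⟩ := mem_atTop_sets.1 hs
    rw [← top_le_iff, ← Real.volume_Ici (a := b)]
    exact measure_mono hb
  rwa [h2] at h1

lemma tendsto_atBot (hu : IsPrim u g) (hui : Integrable u) (hg : Integrable g) :
    Tendsto u atBot (𝓝 0) := by
  have h1 : Tendsto u atBot (𝓝 (u 0 - ∫ t in Set.Iic 0, g t)) := by
    refine Tendsto.congr (f₁ := fun x => u 0 - ∫ t in x..0, g t)
      (fun x => by rw [hu.2]; ring) ?_
    exact tendsto_const_nhds.sub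
      (intervalIntegral_tendsto_integral_Iic 0 hg.integrableOn tendsto_id)
  have h2 : u 0 - ∫ t in Set.Iic 0, g t = 0 := by
    refine IntegrableAtFilter.eq_zero_of_tendsto (μ := volume)
      (hui.integrableAtFilter atBot) (fun s hs => ?_) h1
    obtain ⟨b, hb⟩ := mem_atBot_sets.1 hs
    rw [← top_le_iff, ← Real.volume_Iic (a := b)]
    exact measure_mono hb
  rwa [h2] at h1

/-- The derivative of an integrable function has integral zero if it is integrable. -/
lemma integral_eq_zero (hu : IsPrim u g) (hui : Integrable u) (hg : Integrable g) :
    ∫ x, g x = 0 := by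
  have h1 : Tendsto (fun R : ℝ => ∫ x in (-R)..R, g x) atTop (𝓝 (∫ x, g x)) :=
    intervalIntegral_tendsto_integral hg tendsto_neg_atTop_atBot tendsto_id
  have h2 : Tendsto (fun R : ℝ => ∫ x in (-R)..R, g x) atTop (𝓝 (0 - 0)) := by
    simp only [hu.2]
    exact (hu.tendsto_atTop hui hg).sub
      ((hu.tendsto_atBot hui hg).comp tendsto_neg_atTop_atBot)
  simpa using tendsto_nhds_unique h1 h2

lemma eq_const (hu : IsPrim u (fun _ => 0)) (x y : ℝ) : u x = u y := by
  have := hu.2 y x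
  simp only [intervalIntegral.integral_zero] at this
  linarith

end IsPrim

/-- Smooth compactly supported functions. -/
def IsTest (φ : ℝ → ℝ) : Prop := ContDiff ℝ (⊤ : ℕ∞) φ ∧ HasCompactSupport φ

namespace IsTest

variable {φ ψ u g : ℝ → ℝ}

lemma deriv (h : IsTest φ) : IsTest (deriv φ) :=
  ⟨(contDiff_infty_iff_deriv.1 h.1).2, h.2.deriv⟩

lemma continuous (h : IsTest φ) : Continuous φ := h.1.continuous

lemma integrable (h : IsTest φ) : Integrable φ := h.continuous.integrable_of_hasCompactSupport h.2

lemma memLp (h : IsTest φ) : MemLp φ 2 volume :=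
  h.continuous.memLp_of_hasCompactSupport h.2

lemma isPrim (h : IsTest φ) : IsPrim φ (_root_.deriv φ) :=
  IsPrim.of_hasDerivAt
    (fun x => ((h.1.differentiable (by simp)) x).hasDerivAt) h.deriv.continuous

lemma integrable_mul (h : IsTest φ) (hg : LocallyIntegrable g volume) :
    Integrable (fun x => g x * φ x) := by
  simpa only [smul_eq_mul, mul_comm] using
    hg.integrable_smul_left_of_hasCompactSupport h.continuous h.2

lemma integral_mul_deriv (h : IsTest φ) (hu : IsPrim u g) :
    ∫ x, u x * _root_.deriv φ x = -∫ x, g x * φ x := by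
  have h1 := (hu.mul h.isPrim).integral_eq_zero
    (h.integrable_mul hu.continuous.locallyIntegrable)
    ((h.integrable_mul hu.1).add (h.deriv.integrable_mul hu.continuous.locallyIntegrable))
  rw [integral_add (h.integrable_mul hu.1)
    (h.deriv.integrable_mul hu.continuous.locallyIntegrable)] at h1
  linarith

lemma const_mul (h : IsTest φ) (c : ℝ) : IsTest (fun x => c * φ x) :=
  ⟨contDiff_const.mul h.1, h.2.mul_left⟩

lemma sub (h : IsTest φ) (h' : IsTest ψ) : IsTest (fun x => φ x - ψ x) :=
  ⟨h.1.sub h'.1, h.2.sub h'.2⟩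

/-- The primitive started to the left of the support vanishes again to its right exactly because the
mean is zero. -/
lemma exists_primitive (h : IsTest φ) (h0 : ∫ x, φ x = 0) :
    ∃ Φ, IsTest Φ ∧ _root_.deriv Φ = φ := by
  obtain ⟨R, hR⟩ := h.2.isCompact.isBounded.subset_closedBall 0
  have hz : ∀ x, R < |x| → φ x = 0 := fun x hx => by
    by_contra hne
    have := hR (subset_tsupport φ hne)
    rw [Metric.mem_closedBall, dist_zero_right, Real.norm_eq_abs] at this
    linarith
  let Φ : ℝ → ℝ := fun x => ∫ t in (-(|R| + 1))..x, φ t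
  have hd : ∀ x, HasDerivAt Φ (φ x) x := fun x =>
    (IsPrim.primitive h.continuous.locallyIntegrable _).hasDerivAt h.continuous x
  have hderiv : _root_.deriv Φ = φ := funext fun x => (hd x).deriv
  have hzero : ∀ x, |R| + 1 < |x| → Φ x = 0 := fun x hx => by
    rcases lt_abs.1 hx with h1 | h1
    · have h2 : ∫ t in (-(|R| + 1))..x, φ t = ∫ t, φ t := by
        refine intervalIntegral.integral_eq_integral_of_support_subset fun t ht => ?_
        have h3 : |t| ≤ R := by
          by_contra hcon
          exact ht (hz t (not_le.1 hcon))
        have h4 := abs_le.1 h3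
        have h5 := le_abs_self R
        exact ⟨by linarith, by linarith⟩
      exact h2.trans h0
    · refine intervalIntegral.integral_zero_ae (Eventually.of_forall fun t ht => hz t ?_)
      have h6 := ht.2
      have h5 := le_abs_self R
      have h7 : max (-(|R| + 1)) x = -(|R| + 1) := max_eq_left (by linarith)
      rw [h7] at h6
      have := neg_le_abs t
      linarith
  refine ⟨Φ, ⟨contDiff_infty_iff_deriv.2 ⟨fun x => (hd x).differentiableAt, ?_⟩, ?_⟩, hderiv⟩
  · rw [hderiv]; exact h.1
  · refine HasCompactSupport.intro (isCompact_closedBall (0 : ℝ) (|R| + 1)) fun x hx => hzero x ?_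
    simpa using hx

lemma exists_integral_eq_one : ∃ θ, IsTest θ ∧ ∫ x, θ x = 1 := by
  let b : ContDiffBump (0 : ℝ) := ⟨1, 2, one_pos, one_lt_two⟩
  exact ⟨b.normed volume, ⟨b.contDiff_normed, b.hasCompactSupport_normed⟩, b.integral_normed⟩

end IsTest

lemma ae_eq_of_integral_isTest_eq {f g : ℝ → ℝ} (hf : LocallyIntegrable f volume)
    (hg : LocallyIntegrable g volume) (h : ∀ φ, IsTest φ → ∫ x, f x * φ x = ∫ x, g x * φ x) :
    f =ᵐ[volume] g :=
  ae_eq_of_integral_contDiff_smul_eq hf hg fun φ h1 h2 => by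
    simpa only [smul_eq_mul, mul_comm] using h φ ⟨h1, h2⟩

/-- The du Bois-Reymond lemma. -/
lemma ae_eq_const_of_integral_mul_deriv_eq_zero {r : ℝ → ℝ} (hr : LocallyIntegrable r volume)
    (h : ∀ φ, IsTest φ → ∫ x, r x * deriv φ x = 0) : ∃ c : ℝ, r =ᵐ[volume] fun _ => c := by
  obtain ⟨θ, hθ, hθ1⟩ := IsTest.exists_integral_eq_one
  -- With `∫ θ = 1`, the function `φ - (∫ φ) θ` has mean zero and so is the derivative of a test
  -- function; this fixes the constant as `∫ r θ`.
  refine ⟨∫ x, r x * θ x, ae_eq_of_integral_isTest_eq hr continuous_const.locallyIntegrable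
    fun φ hφ => ?_⟩
  have hc := hθ.const_mul (∫ x, φ x)
  obtain ⟨Φ, hΦ, hd⟩ := (hφ.sub hc).exists_primitive (by
    rw [integral_sub hφ.integrable hc.integrable, integral_const_mul, hθ1, mul_one, sub_self])
  have h1 := h Φ hΦ
  rw [hd] at h1
  have h2 : (fun x => r x * (φ x - (∫ x, φ x) * θ x)) =
      fun x => r x * φ x - (∫ x, φ x) * (r x * θ x) := by
    ext x; ring
  rw [h2, integral_sub (hφ.integrable_mul hr) ((hθ.integrable_mul hr).const_mul _),
    integral_const_mul, sub_eq_zero] at h1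
  rw [h1, integral_const_mul, mul_comm]

/-- A locally integrable function with a locally integrable weak derivative has a primitive as its
representative. -/
lemma exists_isPrim_ae_eq {g k : ℝ → ℝ} (hg : LocallyIntegrable g volume)
    (hk : LocallyIntegrable k volume)
    (h : ∀ φ, IsTest φ → ∫ x, g x * deriv φ x = -∫ x, k x * φ x) :
    ∃ z, IsPrim z k ∧ g =ᵐ[volume] z := by
  have hP : IsPrim (fun x => ∫ t in (0 : ℝ)..x, k t) k := IsPrim.primitive hk 0
  obtain ⟨d, hd⟩ := ae_eq_const_of_integral_mul_deriv_eq_zero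
    (r := fun x => g x - ∫ t in (0 : ℝ)..x, k t)
    (hg.sub hP.continuous.locallyIntegrable) (fun φ hφ => by
      simp only [sub_mul]
      rw [integral_sub (hφ.deriv.integrable_mul hg)
        (hφ.deriv.integrable_mul hP.continuous.locallyIntegrable), h φ hφ, hφ.integral_mul_deriv hP,
        sub_self])
  refine ⟨fun x => d + ∫ t in (0 : ℝ)..x, k t, ((IsPrim.const d).add hP).congr (fun _ => rfl)
    (Eventually.of_forall fun x => zero_add _), hd.mono fun x hx => ?_⟩
  simp only at hx ⊢
  linarith

/-- The second order du Bois-Reymond lemma. -/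
lemma ae_eq_affine_of_integral_mul_deriv_deriv_eq_zero {r : ℝ → ℝ}
    (hr : LocallyIntegrable r volume)
    (h : ∀ φ, IsTest φ → ∫ x, r x * deriv (deriv φ) x = 0) :
    ∃ c d : ℝ, r =ᵐ[volume] fun x => c + d * x := by
  obtain ⟨θ, hθ, hθ1⟩ := IsTest.exists_integral_eq_one
  set b := ∫ x, r x * deriv θ x with hb
  have hlin : LocallyIntegrable (fun x : ℝ => b * x) volume :=
    (continuous_const.mul continuous_id).locallyIntegrable
  have hprim : IsPrim (fun x : ℝ => b * x) (fun _ => b) :=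
    IsPrim.of_hasDerivAt (fun x => by simpa using (hasDerivAt_id x).const_mul b) continuous_const
  -- Testing with `Φ' = φ - (∫ φ) θ` gives `∫ r φ' = b ∫ φ`, so `-b` is the weak derivative of `r`
  -- and `r + b x` is constant.
  obtain ⟨c, hc⟩ := ae_eq_const_of_integral_mul_deriv_eq_zero (r := fun x => r x + b * x)
    (hr.add hlin) (fun φ hφ => by
      have hc := hθ.const_mul (∫ x, φ x)
      obtain ⟨Φ, hΦ, hd⟩ := (hφ.sub hc).exists_primitive (by
        rw [integral_sub hφ.integrable hc.integrable, integral_const_mul, hθ1, mul_one, sub_self])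
      have h1 := h Φ hΦ
      have hdd : deriv (deriv Φ) = fun x => deriv φ x - (∫ x, φ x) * deriv θ x := by
        rw [hd]
        ext x
        exact ((hφ.1.differentiable (by simp) x).hasDerivAt.sub
          ((hθ.1.differentiable (by simp) x).hasDerivAt.const_mul _)).deriv
      rw [hdd] at h1
      have h2 : (fun x => r x * (deriv φ x - (∫ x, φ x) * deriv θ x)) =
          fun x => r x * deriv φ x - (∫ x, φ x) * (r x * deriv θ x) := by
        ext x; ring
      rw [h2, integral_sub (hφ.deriv.integrable_mul hr) ((hθ.deriv.integrable_mul hr).const_mul _),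
        integral_const_mul] at h1
      have h3 := hφ.integral_mul_deriv hprim
      rw [integral_const_mul] at h3
      simp only [add_mul]
      rw [integral_add (hφ.deriv.integrable_mul hr) (hφ.deriv.integrable_mul hlin), h3]
      linarith)
  refine ⟨c, -b, hc.mono fun x hx => ?_⟩
  simp only at hx
  linarith

end Primitive

open Filter Topology
open scoped RealInnerProductSpace

/-! ### Multiplication operators and increment estimates in L²(ℝ). -/

section L2

/-- The real Hilbert space `L²(ℝ)`. -/
abbrev L2R : Type := Lp ℝ 2 (volume : Measure ℝ)

lemma memLp_locallyIntegrable {g : ℝ → ℝ} (hg : MemLp g 2 volume) : LocallyIntegrable g volume :=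
  hg.locallyIntegrable (by norm_num)

lemma L2R.locallyIntegrable (f : L2R) : LocallyIntegrable f volume :=
  memLp_locallyIntegrable (Lp.memLp f)

lemma L2R.inner_eq (f g : L2R) : ⟪f, g⟫ = ∫ x, f x * g x := by
  rw [L2.inner_def]
  exact integral_congr_ae (Eventually.of_forall fun x => by simp [mul_comm])

lemma L2R.inner_eq_of_ae {f g : L2R} {u v : ℝ → ℝ} (hf : f =ᵐ[volume] u) (hg : g =ᵐ[volume] v) :
    ⟪f, g⟫ = ∫ x, u x * v x := by
  rw [L2R.inner_eq]
  exact integral_congr_ae (hf.mul hg)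

lemma L2R.norm_sq_eq_of_ae {f : L2R} {u : ℝ → ℝ} (hf : f =ᵐ[volume] u) :
    ‖f‖ ^ 2 = ∫ x, u x ^ 2 := by
  rw [← real_inner_self_eq_norm_sq, L2R.inner_eq_of_ae hf hf]
  simp only [sq]

lemma integrable_mul_of_memLp {u v : ℝ → ℝ} (hu : MemLp u 2 volume) (hv : MemLp v 2 volume) :
    Integrable (fun x => u x * v x) := hu.integrable_mul hv

lemma memLp_mul_of_abs_le_one {w : ℝ → ℝ} (hw : Measurable w) (hb : ∀ x, |w x| ≤ 1) (f : L2R) :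
    MemLp (fun x => w x * f x) 2 volume :=
  (Lp.memLp f).of_le (hw.aestronglyMeasurable.mul (Lp.aestronglyMeasurable f))
    (Eventually.of_forall fun x => by
      rw [norm_mul]
      exact mul_le_of_le_one_left (norm_nonneg _) (hb x))

/-- Multiplication by a measurable function of absolute value at most `1` on `L²(ℝ)`. -/
def mulL2 (w : ℝ → ℝ) (hw : Measurable w) (hb : ∀ x, |w x| ≤ 1) : L2R →L[ℝ] L2R :=
  have hmem := memLp_mul_of_abs_le_one hw hb
  LinearMap.mkContinuous
    { toFun := fun f => (hmem f).toLp _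
      map_add' := fun f g => by
        ext1
        filter_upwards [(hmem (f + g)).coeFn_toLp, (hmem f).coeFn_toLp, (hmem g).coeFn_toLp,
          Lp.coeFn_add f g, Lp.coeFn_add ((hmem f).toLp _) ((hmem g).toLp _)] with x h1 h2 h3 h4 h5
        rw [h1, h5, Pi.add_apply, h2, h3, h4, Pi.add_apply, mul_add]
      map_smul' := fun c f => by
        ext1
        filter_upwards [(hmem (c • f)).coeFn_toLp, (hmem f).coeFn_toLp, Lp.coeFn_smul c f,
          Lp.coeFn_smul c ((hmem f).toLp _)] with x h1 h2 h3 h4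
        rw [h1, RingHom.id_apply, h4, Pi.smul_apply, h2, h3, Pi.smul_apply, smul_eq_mul,
          smul_eq_mul]
        ring } 1 fun f => by
      rw [one_mul]
      refine Lp.norm_le_norm_of_ae_le ?_
      filter_upwards [(hmem f).coeFn_toLp] with x hx
      change ‖((hmem f).toLp _ : L2R) x‖ ≤ ‖f x‖
      rw [hx, norm_mul]
      exact mul_le_of_le_one_left (norm_nonneg _) (hb x)

lemma coeFn_mulL2 {w : ℝ → ℝ} (hw : Measurable w) (hb : ∀ x, |w x| ≤ 1) (f : L2R) :
    mulL2 w hw hb f =ᵐ[volume] fun x => w x * f x :=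
  MemLp.coeFn_toLp (memLp_mul_of_abs_le_one hw hb f)

lemma norm_mulL2_le {w : ℝ → ℝ} (hw : Measurable w) (hb : ∀ x, |w x| ≤ 1) (f : L2R) :
    ‖mulL2 w hw hb f‖ ≤ ‖f‖ := by
  refine Lp.norm_le_norm_of_ae_le ?_
  filter_upwards [coeFn_mulL2 hw hb f] with x hx
  rw [hx, norm_mul]
  exact mul_le_of_le_one_left (norm_nonneg _) (hb x)

/-- Cauchy–Schwarz for the increment of a function with square integrable derivative. -/
lemma sq_intervalIntegral_le {g : ℝ → ℝ} (hg : MemLp g 2 volume) {a b : ℝ} (hab : a ≤ b) :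
    (∫ x in a..b, g x) ^ 2 ≤ (b - a) * ∫ x, g x ^ 2 := by
  have hfin : volume (Set.Ioc a b) ≠ ⊤ := by simp
  have h1 := L2.inner_indicatorConstLp_one (𝕜 := ℝ) measurableSet_Ioc hfin (hg.toLp g)
  have h2 : ∫ x in Set.Ioc a b, hg.toLp g x = ∫ x in a..b, g x := by
    rw [intervalIntegral.integral_of_le hab]
    exact integral_congr_ae (ae_restrict_of_ae hg.coeFn_toLp)
  rw [h2] at h1
  have h3 := abs_real_inner_le_norm
    (indicatorConstLp 2 measurableSet_Ioc hfin (1 : ℝ)) (hg.toLp g)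
  rw [h1] at h3
  have h4 : ‖indicatorConstLp 2 (measurableSet_Ioc (a := a) (b := b)) hfin (1 : ℝ)‖ ^ 2 = b - a := by
    rw [norm_indicatorConstLp (by norm_num) (by norm_num)]
    simp only [norm_one, one_mul, ENNReal.toReal_ofNat]
    rw [← Real.sqrt_eq_rpow, Real.sq_sqrt measureReal_nonneg, Real.volume_real_Ioc_of_le hab]
  calc (∫ x in a..b, g x) ^ 2 = |∫ x in a..b, g x| ^ 2 := (sq_abs _).symm
    _ ≤ (‖indicatorConstLp 2 (measurableSet_Ioc (a := a) (b := b)) hfin (1 : ℝ)‖ *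
        ‖hg.toLp g‖) ^ 2 := pow_le_pow_left₀ (abs_nonneg _) h3 2
    _ = (b - a) * ∫ x, g x ^ 2 := by
        rw [mul_pow, h4, L2R.norm_sq_eq_of_ae hg.coeFn_toLp]

lemma IsPrim.sq_sub_le {v g : ℝ → ℝ} (h : IsPrim v g) (hg : MemLp g 2 volume) (x y : ℝ) :
    (v x - v y) ^ 2 ≤ |x - y| * ∫ t, g t ^ 2 := by
  rcases le_total x y with hxy | hxy
  · rw [abs_of_nonpos (by linarith), neg_sub, ← neg_sub, neg_sq, ← h.2]
    exact sq_intervalIntegral_le hg hxy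
  · rw [abs_of_nonneg (by linarith), ← h.2]
    exact sq_intervalIntegral_le hg hxy

/-- Deviation of a function from its mean over an interval. -/
lemma IsPrim.sq_sub_average_le {v g : ℝ → ℝ} (h : IsPrim v g) (hg : MemLp g 2 volume)
    {a b x : ℝ} (hab : a < b) (hx : x ∈ Set.Icc a b) :
    (v x - (b - a)⁻¹ * ∫ y in a..b, v y) ^ 2 ≤ (b - a) * ∫ t, g t ^ 2 := by
  have hD : 0 ≤ ∫ t, g t ^ 2 := integral_nonneg fun t => sq_nonneg _
  have hba : 0 < b - a := sub_pos.2 hab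
  have h1 : v x - (b - a)⁻¹ * ∫ y in a..b, v y = (b - a)⁻¹ * ∫ y in a..b, (v x - v y) := by
    rw [intervalIntegral.integral_sub intervalIntegrable_const
      (h.continuous.intervalIntegrable a b), intervalIntegral.integral_const, smul_eq_mul]
    field_simp
  have h2 : ‖∫ y in a..b, (v x - v y)‖ ≤ Real.sqrt ((b - a) * ∫ t, g t ^ 2) * |b - a| := by
    refine intervalIntegral.norm_integral_le_of_norm_le_const fun y hy => ?_
    rw [Set.uIoc_of_le hab.le] at hy
    refine Real.le_sqrt_of_sq_le ?_
    rw [Real.norm_eq_abs, sq_abs]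
    refine (h.sq_sub_le hg x y).trans (mul_le_mul_of_nonneg_right ?_ hD)
    rw [abs_le]
    constructor <;> linarith [hx.1, hx.2, hy.1, hy.2]
  rw [h1, ← sq_abs, abs_mul, abs_of_pos (inv_pos.2 hba)]
  rw [abs_of_pos hba, Real.norm_eq_abs] at h2
  have h3 : (b - a)⁻¹ * |∫ y in a..b, (v x - v y)| ≤ Real.sqrt ((b - a) * ∫ t, g t ^ 2) := by
    rw [inv_mul_le_iff₀ hba, mul_comm]
    exact h2
  calc _ ≤ (Real.sqrt ((b - a) * ∫ t, g t ^ 2)) ^ 2 :=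
        pow_le_pow_left₀ (by positivity) h3 2
    _ = _ := Real.sq_sqrt (by positivity)

end L2

/-! ### The form domain as a Hilbert space embedded in L²(ℝ). -/

section FormSpace

/-- Coefficients of a quadratic form `∫ |v' + s v|² + ∫ m |v|²`, where `m` dominates
`(p + B x)² + 1`. -/
structure FormCoeff (B p : ℝ) where
  /-- the first order coefficient -/
  s : ℝ → ℝ
  /-- the derivative of `s` -/
  s' : ℝ → ℝ
  /-- the weight -/
  m : ℝ → ℝ
  /-- a bound for `s` -/
  C : ℝ
  isPrim_s : IsPrim s s'
  abs_s_le : ∀ x, |s x| ≤ C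
  measurable_m : Measurable m
  le_m : ∀ x, (p + B * x) ^ 2 + 1 ≤ m x
  locallyIntegrable_m : LocallyIntegrable m volume

namespace FormCoeff

variable {B p : ℝ} (c : FormCoeff B p)

lemma one_le_m (x : ℝ) : 1 ≤ c.m x := by nlinarith [c.le_m x, sq_nonneg (p + B * x)]

lemma m_pos (x : ℝ) : 0 < c.m x := one_pos.trans_le (c.one_le_m x)

lemma C_nonneg : 0 ≤ c.C := (abs_nonneg _).trans (c.abs_s_le 0)

lemma continuous_s : Continuous c.s := c.isPrim_s.continuous

lemma memLp_s_mul {u : ℝ → ℝ} (hu : MemLp u 2 volume) : MemLp (fun x => c.s x * u x) 2 volume := by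
  refine (hu.const_mul c.C).of_le
    (c.continuous_s.aestronglyMeasurable.mul hu.aestronglyMeasurable)
    (Eventually.of_forall fun x => ?_)
  rw [norm_mul, norm_mul, Real.norm_eq_abs, Real.norm_eq_abs c.C, abs_of_nonneg c.C_nonneg]
  exact mul_le_mul_of_nonneg_right (c.abs_s_le x) (norm_nonneg _)

/-- The inverse square root of the weight. -/
def w (x : ℝ) : ℝ := (Real.sqrt (c.m x))⁻¹

lemma measurable_w : Measurable c.w := c.measurable_m.sqrt.inv

lemma w_pos (x : ℝ) : 0 < c.w x := inv_pos.2 (Real.sqrt_pos.2 (c.m_pos x))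

lemma abs_w_le (x : ℝ) : |c.w x| ≤ 1 := by
  rw [abs_of_pos (c.w_pos x)]
  refine inv_le_one_of_one_le₀ ?_
  rw [Real.one_le_sqrt]
  exact c.one_le_m x

lemma sqrt_m_mul_w (x : ℝ) : Real.sqrt (c.m x) * c.w x = 1 :=
  mul_inv_cancel₀ (Real.sqrt_pos.2 (c.m_pos x)).ne'

/-- The map `(g, h) ↦ h / √m`. -/
def proj : WithLp 2 (L2R × L2R) →L[ℝ] L2R :=
  (mulL2 c.w c.measurable_w c.abs_w_le).comp (WithLp.sndL 2 ℝ L2R L2R)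

lemma coeFn_proj (x : WithLp 2 (L2R × L2R)) : c.proj x =ᵐ[volume] fun t => c.w t * x.snd t :=
  coeFn_mulL2 c.measurable_w c.abs_w_le _

lemma norm_proj_le (x : WithLp 2 (L2R × L2R)) : ‖c.proj x‖ ≤ ‖x‖ :=
  (norm_mulL2_le c.measurable_w c.abs_w_le _).trans (WithLp.norm_snd_le _ x)

lemma memLp_adjoint {φ : ℝ → ℝ} (hφ : IsTest φ) :
    MemLp (fun x => c.s x * φ x - deriv φ x) 2 volume :=
  (c.memLp_s_mul hφ.memLp).sub hφ.deriv.memLp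

/-- The defect in the weak equation `v' + s v = g`, `v = h / √m`, tested against `φ`. -/
def defect (φ : {φ : ℝ → ℝ // IsTest φ}) : WithLp 2 (L2R × L2R) →L[ℝ] ℝ :=
  (innerSL ℝ (φ.2.memLp.toLp φ.1)).comp (WithLp.fstL 2 ℝ L2R L2R) -
    (innerSL ℝ ((c.memLp_adjoint φ.2).toLp _)).comp c.proj

/-- The form domain, as a closed subspace of `L²(ℝ) × L²(ℝ)`: the pair `(g, h)` stands for the
function `v = h / √m` with `v' + s v = g`. -/
def space : Submodule ℝ (WithLp 2 (L2R × L2R)) :=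
  ⨅ φ, LinearMap.ker (c.defect φ).toLinearMap

lemma isClosed_space : IsClosed (c.space : Set (WithLp 2 (L2R × L2R))) := by
  rw [space, Submodule.coe_iInf]
  exact isClosed_iInter fun φ => (c.defect φ).isClosed_ker

instance : CompleteSpace c.space := c.isClosed_space.completeSpace_coe

lemma mem_space_iff (x : WithLp 2 (L2R × L2R)) :
    x ∈ c.space ↔ ∀ φ, IsTest φ →
      ∫ t, x.fst t * φ t = ∫ t, c.proj x t * (c.s t * φ t - deriv φ t) := by
  rw [space, Submodule.mem_iInf]
  have key : ∀ φ (hφ : IsTest φ), c.defect ⟨φ, hφ⟩ x =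
      (∫ t, x.fst t * φ t) - ∫ t, c.proj x t * (c.s t * φ t - deriv φ t) := fun φ hφ => by
    change ⟪hφ.memLp.toLp φ, x.fst⟫ - ⟪(c.memLp_adjoint hφ).toLp _, c.proj x⟫ = _
    rw [real_inner_comm, real_inner_comm (c.proj x),
      L2R.inner_eq_of_ae (ae_eq_refl _) hφ.memLp.coeFn_toLp,
      L2R.inner_eq_of_ae (ae_eq_refl _) (c.memLp_adjoint hφ).coeFn_toLp]
  constructor
  · intro h φ hφ
    have := h ⟨φ, hφ⟩
    rw [LinearMap.mem_ker] at this
    have h2 := key φ hφ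
    rw [show c.defect ⟨φ, hφ⟩ x = 0 from this] at h2
    linarith
  · rintro h ⟨φ, hφ⟩
    rw [LinearMap.mem_ker]
    change c.defect ⟨φ, hφ⟩ x = 0
    rw [key φ hφ, h φ hφ, sub_self]

/-- The embedding of the form domain into `L²(ℝ)`. -/
def J : c.space →L[ℝ] L2R := c.proj.comp c.space.subtypeL

lemma J_apply (x : c.space) : c.J x = c.proj x := rfl

/-- `v` is a continuous function of finite form energy with `v' + s v = g`. -/
structure HasEnergy (v g : ℝ → ℝ) : Prop where
  isPrim : IsPrim v (fun x => g x - c.s x * v x)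
  memLp_deriv : MemLp g 2 volume
  memLp_weight : MemLp (fun x => Real.sqrt (c.m x) * v x) 2 volume

variable {c} {v g : ℝ → ℝ}

lemma HasEnergy.memLp (h : c.HasEnergy v g) : MemLp v 2 volume := by
  refine h.memLp_weight.of_le h.isPrim.continuous.aestronglyMeasurable
    (Eventually.of_forall fun x => ?_)
  rw [norm_mul, Real.norm_of_nonneg (Real.sqrt_nonneg _)]
  exact le_mul_of_one_le_left (norm_nonneg _) (Real.one_le_sqrt.2 (c.one_le_m x))

lemma HasEnergy.memLp_deriv' (h : c.HasEnergy v g) :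
    MemLp (fun x => g x - c.s x * v x) 2 volume :=
  h.memLp_deriv.sub (c.memLp_s_mul h.memLp)

/-- A function of finite energy defines an element of the form domain. -/
lemma HasEnergy.exists_mem (h : c.HasEnergy v g) :
    ∃ x : c.space, x.1.fst =ᵐ[volume] g ∧ x.1.snd =ᵐ[volume] (fun t => Real.sqrt (c.m t) * v t) ∧
      c.J x =ᵐ[volume] v := by
  let x : WithLp 2 (L2R × L2R) := WithLp.toLp 2 (h.memLp_deriv.toLp g, h.memLp_weight.toLp _)
  have hx1 : x.fst =ᵐ[volume] g := h.memLp_deriv.coeFn_toLp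
  have hx2 : x.snd =ᵐ[volume] (fun t => Real.sqrt (c.m t) * v t) := h.memLp_weight.coeFn_toLp
  have hx3 : c.proj x =ᵐ[volume] v := by
    filter_upwards [c.coeFn_proj x, hx2] with t h1 h2
    rw [h1, h2, ← mul_assoc, mul_comm (c.w t), c.sqrt_m_mul_w, one_mul]
  refine ⟨⟨x, (c.mem_space_iff x).2 fun φ hφ => ?_⟩, hx1, hx2, hx3⟩
  have h1 : ∫ t, x.fst t * φ t = ∫ t, g t * φ t :=
    integral_congr_ae (hx1.mono fun t ht => by simp only [ht])
  have h2 : ∫ t, c.proj x t * (c.s t * φ t - deriv φ t) =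
      ∫ t, v t * (c.s t * φ t - deriv φ t) :=
    integral_congr_ae (hx3.mono fun t ht => by simp only [ht])
  have hi1 : Integrable fun t => v t * deriv φ t :=
    hφ.deriv.integrable_mul h.isPrim.continuous.locallyIntegrable
  have hi2 : Integrable fun t => c.s t * v t * φ t :=
    hφ.integrable_mul (c.continuous_s.mul h.isPrim.continuous).locallyIntegrable
  have hi3 : Integrable fun t => g t * φ t :=
    hφ.integrable_mul (memLp_locallyIntegrable h.memLp_deriv)
  have h3 := hφ.integral_mul_deriv h.isPrim
  simp only [sub_mul] at h3
  rw [integral_sub hi3 hi2] at h3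
  rw [h1, h2]
  have h4 : (fun t => v t * (c.s t * φ t - deriv φ t)) =
      fun t => c.s t * v t * φ t - v t * deriv φ t := by
    ext t; ring
  rw [h4, integral_sub hi2 hi1, h3]
  ring

/-- Every element of the form domain is represented by a function of finite energy. -/
lemma exists_hasEnergy (x : c.space) :
    ∃ v g, c.HasEnergy v g ∧ x.1.fst =ᵐ[volume] g ∧
      x.1.snd =ᵐ[volume] (fun t => Real.sqrt (c.m t) * v t) ∧ c.J x =ᵐ[volume] v := by
  set u : ℝ → ℝ := ⇑(c.J x) with hu
  set g : ℝ → ℝ := ⇑x.1.fst with hg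
  have hul : LocallyIntegrable u volume := L2R.locallyIntegrable _
  have hgl : LocallyIntegrable g volume := L2R.locallyIntegrable _
  have hsul : LocallyIntegrable (fun t => c.s t * u t) volume := hul.continuous_mul c.continuous_s
  obtain ⟨v, hv, huv⟩ := exists_isPrim_ae_eq hul (hgl.sub hsul) (fun φ hφ => by
    have hi1 : Integrable fun t => u t * deriv φ t := hφ.deriv.integrable_mul hul
    have hi2 : Integrable fun t => c.s t * u t * φ t := hφ.integrable_mul hsul
    have hi3 : Integrable fun t => g t * φ t := hφ.integrable_mul hgl
    have h2 : ∫ t, g t * φ t = ∫ t, u t * (c.s t * φ t - deriv φ t) :=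
      (c.mem_space_iff x.1).1 x.2 φ hφ
    have h4 : (fun t => u t * (c.s t * φ t - deriv φ t)) =
        fun t => c.s t * u t * φ t - u t * deriv φ t := by
      ext t; ring
    simp only [Pi.sub_apply, sub_mul]
    rw [integral_sub hi3 hi2, h2, h4, integral_sub hi2 hi1]
    ring)
  have hsnd : x.1.snd =ᵐ[volume] fun t => Real.sqrt (c.m t) * u t := by
    filter_upwards [c.coeFn_proj x.1] with t ht
    rw [hu, J_apply, ht, ← mul_assoc, c.sqrt_m_mul_w, one_mul]
  have hsnd' : x.1.snd =ᵐ[volume] fun t => Real.sqrt (c.m t) * v t :=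
    hsnd.trans (huv.mono fun t ht => by simp only [ht])
  refine ⟨v, g, ⟨?_, Lp.memLp _, (Lp.memLp x.1.snd).ae_eq hsnd'⟩, ae_eq_refl _, hsnd', huv⟩
  exact hv.congr (fun _ => rfl) (huv.mono fun t ht => by rw [Pi.sub_apply, ht])

lemma inner_eq {x y : c.space} {g₁ g₂ v₁ v₂ : ℝ → ℝ} (hx : x.1.fst =ᵐ[volume] g₁)
    (hy : y.1.fst =ᵐ[volume] g₂) (hx' : x.1.snd =ᵐ[volume] fun t => Real.sqrt (c.m t) * v₁ t)
    (hy' : y.1.snd =ᵐ[volume] fun t => Real.sqrt (c.m t) * v₂ t) :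
    ⟪x, y⟫ = (∫ t, g₁ t * g₂ t) + ∫ t, c.m t * (v₁ t * v₂ t) := by
  have h1 : ⟪x, y⟫ = ⟪x.1.fst, y.1.fst⟫ + ⟪x.1.snd, y.1.snd⟫ := rfl
  rw [h1, L2R.inner_eq_of_ae hx hy, L2R.inner_eq_of_ae hx' hy']
  congr 1
  refine integral_congr_ae (Eventually.of_forall fun t => ?_)
  simp only
  nth_rewrite 3 [← Real.mul_self_sqrt (c.m_pos t).le]
  ring

/-- The positive factor `w` recovers the second component from the image; once that vanishes, the
weak equation annihilates the first against every test function. -/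
lemma injective_J : Function.Injective c.J := by
  rw [injective_iff_map_eq_zero]
  intro x hx
  have h0 : c.proj x.1 =ᵐ[volume] 0 := by
    rw [show c.proj x.1 = 0 from hx]
    exact Lp.coeFn_zero _ _ _
  have h1 : x.1.snd = 0 := by
    ext1
    filter_upwards [h0, c.coeFn_proj x.1, Lp.coeFn_zero ℝ 2 (volume : Measure ℝ)] with t h1 h2 h3
    rw [h3]
    rw [h1] at h2
    exact (mul_eq_zero.1 h2.symm).resolve_left (c.w_pos t).ne'
  have h2 : x.1.fst = 0 := by
    ext1
    refine (ae_eq_of_integral_isTest_eq (L2R.locallyIntegrable _) locallyIntegrable_zero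
      fun φ hφ => ?_).trans (Lp.coeFn_zero ℝ 2 (volume : Measure ℝ)).symm
    rw [(c.mem_space_iff x.1).1 x.2 φ hφ]
    simp only [zero_mul, integral_zero]
    refine integral_eq_zero_of_ae (h0.mono fun t ht => ?_)
    simp [ht]
  exact Subtype.ext (WithLp.ofLp_injective 2 (Prod.ext h2 h1))

lemma IsTest.hasEnergy {φ : ℝ → ℝ} (hφ : IsTest φ) :
    c.HasEnergy φ (fun x => deriv φ x + c.s x * φ x) where
  isPrim := hφ.isPrim.congr (fun _ => rfl) (Eventually.of_forall fun x => by ring)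
  memLp_deriv := hφ.deriv.memLp.add (c.memLp_s_mul hφ.memLp)
  memLp_weight := by
    have h1 : AEStronglyMeasurable (fun x => Real.sqrt (c.m x) * φ x) volume :=
      c.measurable_m.sqrt.aestronglyMeasurable.mul hφ.continuous.aestronglyMeasurable
    rw [memLp_two_iff_integrable_sq h1]
    have h2 : Integrable fun x => φ x * c.m x * φ x :=
      hφ.integrable_mul (c.locallyIntegrable_m.continuous_mul hφ.continuous)
    refine h2.congr (Eventually.of_forall fun x => ?_)
    simp only
    rw [mul_pow, Real.sq_sqrt (c.m_pos x).le]
    ring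

/-- Bumps of outer radius 2 centred at `4 n` have disjoint supports up to endpoints, so their images
in L² are nonzero and pairwise orthogonal. -/
lemma not_finiteDimensional_space : ¬ FiniteDimensional ℝ c.space := by
  intro hfd
  let b : ∀ n : ℕ, ContDiffBump ((4 * n : ℝ)) := fun n => ⟨1, 2, one_pos, one_lt_two⟩
  have hb : ∀ n, IsTest (b n) := fun n => ⟨(b n).contDiff, (b n).hasCompactSupport⟩
  choose x _ _ hx using fun n => (IsTest.hasEnergy (c := c) (hb n)).exists_mem
  have hne : ∀ n, c.J (x n) ≠ 0 := fun n h0 => by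
    have h1 : (b n : ℝ → ℝ) =ᵐ[volume] fun _ => 0 := by
      refine (hx n).symm.trans ?_
      rw [h0]
      exact Lp.coeFn_zero _ _ _
    have h2 := (Continuous.ae_eq_iff_eq volume (hb n).continuous continuous_const).1 h1
    have h3 := congrFun h2 (4 * n : ℝ)
    have h4 := (b n).one_of_mem_closedBall (x := (4 * n : ℝ)) (by simp [b])
    rw [h3] at h4
    exact zero_ne_one h4
  have horth : Pairwise fun i j => ⟪c.J (x i), c.J (x j)⟫ = 0 := fun i j hij => by
    change ⟪c.J (x i), c.J (x j)⟫ = 0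
    rw [L2R.inner_eq_of_ae (hx i) (hx j)]
    refine integral_eq_zero_of_ae (Eventually.of_forall fun t => ?_)
    by_contra hcon
    have h1 : b i t ≠ 0 := left_ne_zero_of_mul hcon
    have h2 : b j t ≠ 0 := right_ne_zero_of_mul hcon
    have h3 : dist t (4 * i : ℝ) < 2 := by
      by_contra h
      exact h1 ((b i).zero_of_le_dist (not_lt.1 h))
    have h4 : dist t (4 * j : ℝ) < 2 := by
      by_contra h
      exact h2 ((b j).zero_of_le_dist (not_lt.1 h))
    rw [Real.dist_eq, abs_lt] at h3 h4
    have h5 : (i : ℝ) < j + 1 := by linarith [h3.1, h3.2, h4.1, h4.2]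
    have h6 : (j : ℝ) < i + 1 := by linarith [h3.1, h3.2, h4.1, h4.2]
    have h7 : i < j + 1 := by exact_mod_cast h5
    have h8 : j < i + 1 := by exact_mod_cast h6
    omega
  have hli : LinearIndependent ℝ (fun n => c.J (x n)) :=
    linearIndependent_of_ne_zero_of_inner_eq_zero hne horth
  have hli' : LinearIndependent ℝ x :=
    LinearIndependent.of_comp (c.J : c.space →ₗ[ℝ] L2R) hli
  have := hli'.finite_of_isNoetherian
  exact not_finite ℕ

end FormCoeff

end FormSpace

open Filter Topology
open scoped RealInnerProductSpace

/-! ### Compactness of the embedding, by finite rank averaging. -/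

section Compactness

/-- The `i`-th cell of the partition of `[-M, M)` into intervals of length `M⁻²`. -/
def cell (M i : ℕ) : Set ℝ :=
  Set.Ico (-(M : ℝ) + i / (M : ℝ) ^ 2) (-(M : ℝ) + (i + 1) / (M : ℝ) ^ 2)

lemma measurableSet_cell (M i : ℕ) : MeasurableSet (cell M i) := measurableSet_Ico

lemma volume_cell_ne_top (M i : ℕ) : volume (cell M i) ≠ ⊤ := by simp [cell]

/-- The indicator function of a cell. -/
def cellL2 (M i : ℕ) : L2R :=
  indicatorConstLp 2 (measurableSet_cell M i) (volume_cell_ne_top M i) 1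

/-- Averaging over the cells of the partition of `[-M, M)`. -/
def averageOp (M : ℕ) : L2R →L[ℝ] L2R :=
  ∑ i ∈ Finset.range (2 * M * M ^ 2),
    ((M : ℝ) ^ 2) • (innerSL ℝ (cellL2 M i)).smulRight (cellL2 M i)

lemma averageOp_apply (M : ℕ) (f : L2R) : averageOp M f =
    ∑ i ∈ Finset.range (2 * M * M ^ 2), ((M : ℝ) ^ 2 * ∫ x in cell M i, f x) • cellL2 M i := by
  simp only [averageOp, sum_apply, smul_apply,
    ContinuousLinearMap.smulRight_apply, innerSL_apply_apply, smul_smul]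
  refine Finset.sum_congr rfl fun i _ => ?_
  rw [cellL2, L2.inner_indicatorConstLp_one]

lemma mem_cell_iff {M : ℕ} (hM : 0 < M) {x : ℝ} (hx : -(M : ℝ) ≤ x) (i : ℕ) :
    x ∈ cell M i ↔ i = ⌊(x + M) * (M : ℝ) ^ 2⌋₊ := by
  have hM' : (0 : ℝ) < (M : ℝ) ^ 2 := by positivity
  have h0 : 0 ≤ (x + M) * (M : ℝ) ^ 2 := mul_nonneg (by linarith) hM'.le
  rw [eq_comm, Nat.floor_eq_iff h0, cell, Set.mem_Ico]
  constructor
  · rintro ⟨h1, h2⟩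
    refine ⟨(div_le_iff₀ hM').1 (by linarith), (lt_div_iff₀ hM').1 (by linarith)⟩
  · rintro ⟨h1, h2⟩
    have h3 := (div_le_iff₀ hM').2 h1
    have h4 := (lt_div_iff₀ hM').2 h2
    constructor <;> linarith

lemma cell_subset {M i : ℕ} (hM : 0 < M) (hi : i < 2 * M * M ^ 2) :
    cell M i ⊆ Set.Ico (-(M : ℝ)) M := by
  intro x hx
  have hM' : (0 : ℝ) < (M : ℝ) ^ 2 := by positivity
  have h1 : (0 : ℝ) ≤ i / (M : ℝ) ^ 2 := by positivity
  have h2 : ((i : ℝ) + 1) / (M : ℝ) ^ 2 ≤ 2 * M := by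
    rw [div_le_iff₀ hM']
    exact_mod_cast Nat.succ_le_of_lt hi
  exact ⟨by linarith [hx.1], by linarith [hx.2]⟩

lemma averageOp_ae_eq {M : ℕ} (hM : 0 < M) {f : L2R} {v : ℝ → ℝ} (hf : f =ᵐ[volume] v) :
    ∀ᵐ x, (x ∉ Set.Ico (-(M : ℝ)) M → averageOp M f x = 0) ∧
      (x ∈ Set.Ico (-(M : ℝ)) M → ∃ i, x ∈ cell M i ∧
        averageOp M f x = (M : ℝ) ^ 2 * ∫ y in cell M i, v y) := by
  rw [averageOp_apply]
  have h1 : ∀ᵐ x, ∀ i : ℕ, cellL2 M i x = (cell M i).indicator (fun _ => (1 : ℝ)) x :=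
    ae_all_iff.2 fun i => indicatorConstLp_coeFn
  have h2 : ∀ᵐ x, ∀ i : ℕ, (((M : ℝ) ^ 2 * ∫ x in cell M i, f x) • cellL2 M i : L2R) x =
      ((M : ℝ) ^ 2 * ∫ x in cell M i, f x) * cellL2 M i x :=
    ae_all_iff.2 fun i => Lp.coeFn_smul _ _
  filter_upwards [h1, h2, Lp.coeFn_finsetSum (Finset.range (2 * M * M ^ 2))
    fun i => ((M : ℝ) ^ 2 * ∫ x in cell M i, f x) • cellL2 M i] with x hx1 hx2 hx3
  have hval : (∑ i ∈ Finset.range (2 * M * M ^ 2),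
      ((M : ℝ) ^ 2 * ∫ x in cell M i, f x) • cellL2 M i : L2R) x =
      ∑ i ∈ Finset.range (2 * M * M ^ 2), ((M : ℝ) ^ 2 * ∫ x in cell M i, f x) *
        (cell M i).indicator (fun _ => (1 : ℝ)) x := by
    rw [hx3, Finset.sum_apply]
    exact Finset.sum_congr rfl fun i _ => by rw [hx2, hx1]
  rw [hval]
  refine ⟨fun hx => Finset.sum_eq_zero fun i hi => ?_, fun hx => ?_⟩
  · rw [Set.indicator_of_notMem fun h => hx (cell_subset hM (Finset.mem_range.1 hi) h), mul_zero]
  · have hmem := (mem_cell_iff hM hx.1 _).2 rfl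
    refine ⟨_, hmem, ?_⟩
    rw [Finset.sum_eq_single ⌊(x + M) * (M : ℝ) ^ 2⌋₊]
    · rw [Set.indicator_of_mem hmem, mul_one]
      congr 1
      exact integral_congr_ae (ae_restrict_of_ae hf)
    · intro j _ hj
      rw [Set.indicator_of_notMem fun h => hj ((mem_cell_iff hM hx.1 j).1 h), mul_zero]
    · intro h
      exfalso
      refine h (Finset.mem_range.2 ?_)
      have hM' : (0 : ℝ) < (M : ℝ) ^ 2 := by positivity
      rw [Nat.floor_lt (mul_nonneg (by linarith [hx.1]) hM'.le)]
      push_cast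
      exact mul_lt_mul_of_pos_right (by linarith [hx.2]) hM'

lemma isCompactOperator_averageOp (M : ℕ) : IsCompactOperator (averageOp M) := by
  have h : ∀ s : Finset ℕ, IsCompactOperator (∑ i ∈ s,
      ((M : ℝ) ^ 2) • (innerSL ℝ (cellL2 M i)).smulRight (cellL2 M i) : L2R →L[ℝ] L2R) := by
    intro s
    induction s using Finset.induction_on with
    | empty => exact isCompactOperator_zero
    | insert i s hi ih =>
      rw [Finset.sum_insert hi]
      refine IsCompactOperator.add (IsCompactOperator.smul ?_ _) ih
      have h1 : IsCompactOperator (ContinuousLinearMap.toSpanSingleton ℝ (cellL2 M i)) :=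
        isCompactOperator_of_locallyCompactSpace_rng
          (ContinuousLinearMap.toSpanSingleton ℝ (cellL2 M i))
      exact h1.comp_clm (innerSL ℝ (cellL2 M i))
  exact h _

lemma IsPrim.sq_sub_cell_average_le {v g : ℝ → ℝ} (h : IsPrim v g) (hg : MemLp g 2 volume)
    {M i : ℕ} (hM : 0 < M) {x : ℝ} (hx : x ∈ cell M i) :
    (v x - (M : ℝ) ^ 2 * ∫ y in cell M i, v y) ^ 2 ≤ ((M : ℝ) ^ 2)⁻¹ * ∫ t, g t ^ 2 := by
  have hM' : (0 : ℝ) < (M : ℝ) ^ 2 := by positivity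
  have hlen : (-(M : ℝ) + (i + 1) / (M : ℝ) ^ 2) - (-(M : ℝ) + i / (M : ℝ) ^ 2) =
      ((M : ℝ) ^ 2)⁻¹ := by field_simp; ring
  have hlt : -(M : ℝ) + i / (M : ℝ) ^ 2 < -(M : ℝ) + (i + 1) / (M : ℝ) ^ 2 := by
    rw [← sub_pos, hlen]; positivity
  have h1 := h.sq_sub_average_le hg hlt (Set.Ico_subset_Icc_self hx)
  rw [hlen, inv_inv, intervalIntegral.integral_of_le hlt.le, ← integral_Ico_eq_integral_Ioc] at h1
  exact h1

namespace FormCoeff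

variable {B p : ℝ} (c : FormCoeff B p)

lemma integral_weight_nonneg (v : ℝ → ℝ) : 0 ≤ ∫ t, c.m t * (v t * v t) :=
  integral_nonneg fun t => mul_nonneg (c.m_pos t).le (mul_self_nonneg _)

variable {c} in
lemma HasEnergy.integrable_weight {v g : ℝ → ℝ} (h : c.HasEnergy v g) :
    Integrable fun t => c.m t * (v t * v t) := by
  refine h.memLp_weight.integrable_sq.congr (Eventually.of_forall fun t => ?_)
  simp only
  rw [mul_pow, Real.sq_sqrt (c.m_pos t).le]
  ring

/-- Outside `[-M, M)` the weight is of order `M²`. -/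
lemma sq_le_weight (hB : 0 < B) {M : ℕ} (hM : 0 < M) {x : ℝ} (hx : x ∉ Set.Ico (-(M : ℝ)) M)
    (a : ℝ) : a ^ 2 ≤ 2 * (1 + p ^ 2) / B ^ 2 / M * (c.m x * (a * a)) := by
  have hM1 : (1 : ℝ) ≤ M := by exact_mod_cast hM
  have hxM : (M : ℝ) ^ 2 ≤ x ^ 2 := by
    rw [Set.mem_Ico, not_and_or, not_le, not_lt] at hx
    rcases hx with h | h <;> nlinarith
  -- Only `M ≤ M ^ 2 ≤ x ^ 2` is used: a decay of order `1 / M` suffices, as the averaging error on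
  -- `[-M, M)` is of that order too.
  have h1 : B ^ 2 * M ≤ 2 * (1 + p ^ 2) * c.m x := by
    have h2 : B ^ 2 * M ≤ B ^ 2 * x ^ 2 :=
      mul_le_mul_of_nonneg_left (by nlinarith) (sq_nonneg B)
    have h3 : B ^ 2 * x ^ 2 ≤ 2 * (p + B * x) ^ 2 + 2 * p ^ 2 := by
      nlinarith [sq_nonneg (2 * p + B * x)]
    have h4 := c.le_m x
    nlinarith [sq_nonneg p, c.one_le_m x, mul_nonneg (sq_nonneg p) (c.m_pos x).le,
      mul_nonneg (sq_nonneg p) (sub_nonneg.2 (c.one_le_m x))]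
  have h5 : 1 ≤ 2 * (1 + p ^ 2) / B ^ 2 / M * c.m x := by
    rw [div_div, div_mul_eq_mul_div, one_le_div (by positivity)]
    exact h1
  nlinarith [mul_self_nonneg a, mul_le_mul_of_nonneg_right h5 (mul_self_nonneg a)]

/-- The embedding of the form domain is approximated by finite rank operators. -/
lemma norm_sub_averageOp_le (hB : 0 < B) {M : ℕ} (hM : 0 < M) (x : c.space) :
    ‖c.J x - averageOp M (c.J x)‖ ^ 2 ≤
      (4 * (1 + c.C ^ 2) + 2 * (1 + p ^ 2) / B ^ 2) / M * ‖x‖ ^ 2 := by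
  obtain ⟨v, g, h, hfst, hsnd, hJ⟩ := c.exists_hasEnergy x
  set D := ∫ t, (g t - c.s t * v t) ^ 2 with hD
  set κ := 2 * (1 + p ^ 2) / B ^ 2 with hκ
  have hκ0 : 0 ≤ κ := by positivity
  have hM0 : (0 : ℝ) < M := by exact_mod_cast hM
  have hD0 : 0 ≤ D := integral_nonneg fun t => sq_nonneg _
  have hnorm : ‖x‖ ^ 2 = (∫ t, g t * g t) + ∫ t, c.m t * (v t * v t) := by
    rw [← real_inner_self_eq_norm_sq, c.inner_eq hfst hfst hsnd hsnd]
  have hg0 : 0 ≤ ∫ t, g t * g t := integral_nonneg fun t => mul_self_nonneg _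
  have hm0 := c.integral_weight_nonneg v
  have hv : ∫ t, v t ^ 2 ≤ ∫ t, c.m t * (v t * v t) := by
    refine integral_mono h.memLp.integrable_sq h.integrable_weight fun t => ?_
    simp only
    nlinarith [c.one_le_m t, mul_self_nonneg (v t)]
  -- `D` is the squared norm of `v' = g - s v`, controlled by the energy because `s` is bounded.
  have hDle : D ≤ 2 * (1 + c.C ^ 2) * ‖x‖ ^ 2 := by
    have h1 : D ≤ ∫ t, (2 * (g t * g t) + 2 * c.C ^ 2 * v t ^ 2) := by
      refine integral_mono h.memLp_deriv'.integrable_sq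
        (((integrable_mul_of_memLp h.memLp_deriv h.memLp_deriv).const_mul 2).add
          (h.memLp.integrable_sq.const_mul _)) fun t => ?_
      simp only
      have h2 : (c.s t * v t) ^ 2 ≤ c.C ^ 2 * v t ^ 2 := by
        rw [mul_pow]
        refine mul_le_mul_of_nonneg_right ?_ (sq_nonneg _)
        rw [← sq_abs]
        exact pow_le_pow_left₀ (abs_nonneg _) (c.abs_s_le t) 2
      nlinarith [sq_nonneg (g t + c.s t * v t)]
    rw [integral_add ((integrable_mul_of_memLp h.memLp_deriv h.memLp_deriv).const_mul 2)
      (h.memLp.integrable_sq.const_mul _), integral_const_mul, integral_const_mul] at h1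
    rw [hnorm]
    have hC2 := sq_nonneg c.C
    nlinarith [mul_nonneg hC2 hg0, mul_nonneg hC2 (sub_nonneg.2 hv)]
  have hae : (c.J x - averageOp M (c.J x) : L2R) =ᵐ[volume]
      fun t => v t - averageOp M (c.J x) t := by
    filter_upwards [Lp.coeFn_sub (c.J x) (averageOp M (c.J x)), hJ] with t h1 h2
    rw [h1, Pi.sub_apply, h2]
  have hint : Integrable (fun t => (v t - averageOp M (c.J x) t) ^ 2) :=
    ((Lp.memLp (c.J x - averageOp M (c.J x))).ae_eq hae).integrable_sq
  have hind : Integrable ((Set.Ico (-(M : ℝ)) M).indicator fun _ => ((M : ℝ) ^ 2)⁻¹ * D) :=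
    (integrable_indicator_iff measurableSet_Ico).2 (integrableOn_const (by simp))
  rw [L2R.norm_sq_eq_of_ae hae]
  calc ∫ t, (v t - averageOp M (c.J x) t) ^ 2
      -- Inside `[-M, M)` the squared deviation from a cell average is at most the cell length `M⁻²`
      -- times `D`; outside, the average is zero and the weight bounds `v²`.
      ≤ ∫ t, ((Set.Ico (-(M : ℝ)) M).indicator (fun _ => ((M : ℝ) ^ 2)⁻¹ * D) t +
          κ / M * (c.m t * (v t * v t))) := by
        refine integral_mono_ae hint (hind.add (h.integrable_weight.const_mul _)) ?_
        filter_upwards [averageOp_ae_eq hM hJ] with t ht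
        have hw0 : 0 ≤ κ / M * (c.m t * (v t * v t)) :=
          mul_nonneg (by positivity) (mul_nonneg (c.m_pos t).le (mul_self_nonneg _))
        by_cases htM : t ∈ Set.Ico (-(M : ℝ)) M
        · obtain ⟨i, hi, hval⟩ := ht.2 htM
          rw [Set.indicator_of_mem htM, hval]
          have := h.isPrim.sq_sub_cell_average_le h.memLp_deriv' hM hi
          linarith
        · rw [Set.indicator_of_notMem htM, ht.1 htM, sub_zero, zero_add]
          exact c.sq_le_weight hB hM htM (v t)
    _ = 2 * M * (((M : ℝ) ^ 2)⁻¹ * D) + κ / M * ∫ t, c.m t * (v t * v t) := by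
        rw [integral_add hind (h.integrable_weight.const_mul _), integral_const_mul,
          integral_indicator measurableSet_Ico, setIntegral_const, smul_eq_mul,
          Real.volume_real_Ico_of_le (by linarith)]
        ring
    _ = (2 * D + κ * ∫ t, c.m t * (v t * v t)) / M := by field_simp
    _ ≤ (4 * (1 + c.C ^ 2) * ‖x‖ ^ 2 + κ * ‖x‖ ^ 2) / M := by
        refine div_le_div_of_nonneg_right (add_le_add (by linarith) ?_) hM0.le
        exact mul_le_mul_of_nonneg_left (by linarith) hκ0
    _ = (4 * (1 + c.C ^ 2) + κ) / M * ‖x‖ ^ 2 := by ring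

/-- The embedding of the form domain into `L²(ℝ)` is compact. -/
lemma isCompactOperator_J (hB : 0 < B) : IsCompactOperator c.J := by
  set A := 4 * (1 + c.C ^ 2) + 2 * (1 + p ^ 2) / B ^ 2 with hA
  have hA0 : 0 ≤ A := by positivity
  -- The shift to `n + 1` keeps the partition parameter positive.
  refine isCompactOperator_of_tendsto (l := atTop) (F := fun n : ℕ => (averageOp (n + 1)).comp c.J)
    ?_ (Eventually.of_forall fun n => (isCompactOperator_averageOp (n + 1)).comp_clm c.J)
  refine (tendsto_iff_norm_sub_tendsto_zero (E := c.space →L[ℝ] L2R)).2 ?_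
  have hlim : Tendsto (fun n : ℕ => Real.sqrt (A / ((n + 1 : ℕ) : ℝ))) atTop (𝓝 0) := by
    have h1 : Tendsto (fun n : ℕ => A / ((n + 1 : ℕ) : ℝ)) atTop (𝓝 0) :=
      (tendsto_const_div_atTop_nhds_zero_nat A).comp (tendsto_add_atTop_nat 1)
    simpa using h1.sqrt
  refine squeeze_zero (fun n => ContinuousLinearMap.opNorm_nonneg _) (fun n => ?_) hlim
  refine ContinuousLinearMap.opNorm_le_bound _ (Real.sqrt_nonneg _) fun x => ?_
  have h1 := c.norm_sub_averageOp_le hB (Nat.succ_pos n) x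
  rw [← norm_neg]
  have h2 : -(((averageOp (n + 1)).comp c.J - c.J) x) = c.J x - averageOp (n + 1) (c.J x) := by
    simp
  rw [h2]
  refine (sq_le_sq₀ (norm_nonneg _) (by positivity)).1 ?_
  rw [mul_pow, Real.sq_sqrt (by positivity)]
  exact h1

end FormCoeff

end Compactness

open Filter Topology
open scoped RealInnerProductSpace

/-! ### The eigenvalue equation as a first order system: uniqueness, finite energy, simplicity. -/

section Solutions

namespace FormCoeff

variable {B p : ℝ} (c : FormCoeff B p)

/-- Solutions of `-u'' + (m + s² - s') u = l u`, written as a first order system for `u` and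
`z = u' + s u`. -/
structure IsSol (l : ℝ) (u z : ℝ → ℝ) : Prop where
  isPrim_fst : IsPrim u (fun x => z x - c.s x * u x)
  isPrim_snd : IsPrim z (fun x => c.s x * z x + (c.m x - l) * u x)

variable {c} {l : ℝ} {u z u₁ z₁ u₂ z₂ : ℝ → ℝ}

namespace IsSol

lemma sub_const_mul (h₁ : c.IsSol l u₁ z₁) (h₂ : c.IsSol l u₂ z₂) (a : ℝ) :
    c.IsSol l (fun x => u₂ x - a * u₁ x) (fun x => z₂ x - a * z₁ x) :=
  ⟨(h₂.isPrim_fst.sub (h₁.isPrim_fst.const_mul a)).congr (fun _ => rfl)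
    (Eventually.of_forall fun x => by ring),
   (h₂.isPrim_snd.sub (h₁.isPrim_snd.const_mul a)).congr (fun _ => rfl)
    (Eventually.of_forall fun x => by ring)⟩

lemma isPrim_energy (h : c.IsSol l u z) : IsPrim (fun x => u x * z x)
    (fun x => z x ^ 2 + c.m x * u x ^ 2 - l * u x ^ 2) :=
  (h.isPrim_fst.mul h.isPrim_snd).congr (fun _ => rfl) (Eventually.of_forall fun x => by ring)

/-- A solution with zero Cauchy data vanishes. -/
lemma eq_zero (h : c.IsSol l u z) (hu : u 0 = 0) (hz : z 0 = 0) (x : ℝ) : u x = 0 := by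
  set y : ℝ → ℝ := fun x => u x * u x + z x * z x with hy
  set κ : ℝ → ℝ := fun x => 1 + 2 * c.C + |c.m x - l| with hκ
  have hκl : LocallyIntegrable κ volume := by
    have h1 : LocallyIntegrable (fun x => c.m x - l) volume :=
      c.locallyIntegrable_m.sub (continuous_const (y := l)).locallyIntegrable
    exact (continuous_const (y := 1 + 2 * c.C)).locallyIntegrable.add
      (locallyIntegrable_iff.2 fun k hk => (h1.integrableOn_isCompact hk).norm)
  have hyp := (h.isPrim_fst.mul h.isPrim_fst).add (h.isPrim_snd.mul h.isPrim_snd)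
  have hyc : Continuous y := hyp.continuous
  have hy0 : ∀ x, 0 ≤ y x := fun x =>
    add_nonneg (mul_self_nonneg _) (mul_self_nonneg _)
  have hKp := IsPrim.primitive hκl 0
  -- The inequality `|y'| ≤ κ y` replaces Gronwall: near a zero of `y`, on a ball where `κ`
  -- integrates to at most `1/2`, the maximum of `y` is at most half of itself. The zero set is thus
  -- clopen.
  have hopen : IsOpen {x | y x = 0} := by
    rw [Metric.isOpen_iff]
    intro x₀ hx₀
    obtain ⟨δ, hδ, hK⟩ := Metric.continuous_iff.1 hKp.continuous x₀ (1 / 2) (by norm_num)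
    refine ⟨δ / 2, by positivity, fun x hx => ?_⟩
    obtain ⟨x₁, hx₁, hmax⟩ := (isCompact_closedBall x₀ (δ / 2)).exists_isMaxOn
      ⟨x₀, Metric.mem_closedBall_self (by positivity)⟩ hyc.continuousOn
    have hint := hyp.2 x₀ x₁
    have hle : ‖∫ t in x₀..x₁, ((z t - c.s t * u t) * u t + u t * (z t - c.s t * u t) +
        ((c.s t * z t + (c.m t - l) * u t) * z t + z t * (c.s t * z t + (c.m t - l) * u t)))‖ ≤
        |∫ t in x₀..x₁, κ t * y x₁| := by
      refine intervalIntegral.norm_integral_le_abs_of_norm_le ?_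
        ((hκl.intervalIntegrable' x₀ x₁).mul_const _)
      rw [ae_restrict_iff' measurableSet_uIoc]
      refine Eventually.of_forall fun t ht => ?_
      have ht' : t ∈ Metric.closedBall x₀ (δ / 2) := by
        have h1 := Set.uIoc_subset_uIcc ht
        rw [Metric.mem_closedBall, Real.dist_eq] at hx₁ ⊢
        exact (Set.abs_sub_left_of_mem_uIcc h1).trans hx₁
      have hyt : y t ≤ y x₁ := hmax ht'
      have hκ0 : 0 ≤ κ t := by
        have := c.C_nonneg
        simp only [hκ]; positivity
      refine le_trans ?_ (mul_le_mul_of_nonneg_left hyt hκ0)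
      simp only [hκ, hy, Real.norm_eq_abs]
      have hs := abs_le.1 (c.abs_s_le t)
      have hm1 := le_abs_self (c.m t - l)
      have hm2 := neg_abs_le (c.m t - l)
      set q := |c.m t - l|
      have e1 : 0 ≤ (u t - z t) ^ 2 := sq_nonneg _
      have e2 : 0 ≤ (u t + z t) ^ 2 := sq_nonneg _
      have e3 : 0 ≤ u t ^ 2 := sq_nonneg _
      have e4 : 0 ≤ z t ^ 2 := sq_nonneg _
      have k1 := mul_nonneg (sub_nonneg.2 hs.2) e3
      have k2 := mul_nonneg (sub_nonneg.2 hs.2) e4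
      have k3 := mul_nonneg (sub_nonneg.2 hs.1) e3
      have k4 := mul_nonneg (sub_nonneg.2 hs.1) e4
      have k5 := mul_nonneg (sub_nonneg.2 hm1) e1
      have k6 := mul_nonneg (sub_nonneg.2 hm1) e2
      have k7 := mul_nonneg (sub_nonneg.2 hm2) e1
      have k8 := mul_nonneg (sub_nonneg.2 hm2) e2
      rw [abs_le]
      constructor <;> nlinarith
    rw [hint, intervalIntegral.integral_mul_const, abs_mul, abs_of_nonneg (hy0 x₁)] at hle
    have h2 : |∫ t in x₀..x₁, κ t| ≤ 1 / 2 := by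
      rw [hKp.2]
      refine (hK x₁ ?_).le
      rw [Metric.mem_closedBall] at hx₁
      linarith
    have hle' : |y x₁ - y x₀| ≤ |∫ t in x₀..x₁, κ t| * y x₁ := hle
    rw [show y x₀ = 0 from hx₀, sub_zero, abs_of_nonneg (hy0 x₁)] at hle'
    have h3 : y x₁ ≤ 0 := by nlinarith [hy0 x₁]
    exact le_antisymm ((hmax (Metric.ball_subset_closedBall hx)).trans h3) (hy0 x)
  have huniv : {x | y x = 0} = Set.univ :=
    IsClopen.eq_univ ⟨isClosed_eq hyc continuous_const, hopen⟩ ⟨0, by simp [hy, hu, hz]⟩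
  have hx : y x = 0 := by
    have : x ∈ {x | y x = 0} := huniv ▸ Set.mem_univ x
    exact this
  have h3 : u x * u x = 0 := by
    have h1 := mul_self_nonneg (u x)
    have h2 := mul_self_nonneg (z x)
    simp only [hy] at hx
    linarith
  exact mul_self_eq_zero.1 h3

lemma isPrim_sq (h : c.IsSol l u z) : IsPrim (fun x => u x ^ 2)
    (fun x => 2 * (u x * z x) - 2 * (c.s x * u x ^ 2)) :=
  (h.isPrim_fst.mul h.isPrim_fst).congr (fun x => (sq _).symm)
    (Eventually.of_forall fun x => by ring)

lemma locallyIntegrable_energy (h : c.IsSol l u z) :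
    LocallyIntegrable (fun x => z x ^ 2 + c.m x * u x ^ 2) volume := by
  have hu : Continuous fun x => u x ^ 2 := h.isPrim_fst.continuous.pow 2
  have h1 : LocallyIntegrable (fun x => c.m x * u x ^ 2) volume := by
    simpa only [mul_comm] using c.locallyIntegrable_m.continuous_mul hu
  exact (h.isPrim_snd.continuous.pow 2).locallyIntegrable.add h1

lemma _root_.LandauPotential.FormCoeff.abs_integral_s_mul_sq_le (c : FormCoeff B p)
    (hu : MemLp u 2 volume) {a b : ℝ} (hab : a ≤ b) : |∫ x in a..b, c.s x * u x ^ 2| ≤ c.C * ∫ x, u x ^ 2 := by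
  rw [intervalIntegral.integral_of_le hab, ← Real.norm_eq_abs]
  calc ‖∫ x in Set.Ioc a b, c.s x * u x ^ 2‖ ≤ ∫ x in Set.Ioc a b, c.C * u x ^ 2 := by
        refine norm_integral_le_of_norm_le (hu.integrable_sq.const_mul _).integrableOn
          (Eventually.of_forall fun x => ?_)
        rw [norm_mul, Real.norm_eq_abs, Real.norm_of_nonneg (sq_nonneg _)]
        exact mul_le_mul_of_nonneg_right (c.abs_s_le x) (sq_nonneg _)
    _ ≤ ∫ x, c.C * u x ^ 2 := setIntegral_le_integral (hu.integrable_sq.const_mul _)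
        (Eventually.of_forall fun x => mul_nonneg c.C_nonneg (sq_nonneg _))
    _ = _ := integral_const_mul _ _

/-- The energy of a square integrable solution over symmetric intervals is bounded. -/
lemma energy_le (h : c.IsSol l u z) (hu : MemLp u 2 volume) {R₀ : ℝ} (hR₀ : 0 ≤ R₀) :
    ∫ x in (-R₀)..R₀, (z x ^ 2 + c.m x * u x ^ 2) ≤ |l| * (∫ x, u x ^ 2) + 1 := by
  by_contra hcon
  push Not at hcon
  set A := ∫ x, u x ^ 2 with hA
  have hA0 : 0 ≤ A := integral_nonneg fun x => sq_nonneg _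
  have hF := h.locallyIntegrable_energy.intervalIntegrable'
  have hF0 : ∀ x, 0 ≤ z x ^ 2 + c.m x * u x ^ 2 := fun x =>
    add_nonneg (sq_nonneg _) (mul_nonneg (c.m_pos x).le (sq_nonneg _))
  have hui := hu.integrable_sq
  have hucont := h.isPrim_fst.continuous
  -- The boundary term of the energy identity equals the energy minus `l ∫ u²`, so an energy above
  -- `|l| A + 1` keeps it at least 1 on all larger intervals.
  have hP : ∀ r, R₀ ≤ r → 1 ≤ u r * z r - u (-r) * z (-r) := fun r hr => by
    rw [← h.isPrim_energy.2 (-r) r, intervalIntegral.integral_sub (hF _ _)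
      (hui.const_mul l).intervalIntegrable, intervalIntegral.integral_const_mul]
    have h1 : ∫ x in (-R₀)..R₀, (z x ^ 2 + c.m x * u x ^ 2) ≤
        ∫ x in (-r)..r, (z x ^ 2 + c.m x * u x ^ 2) :=
      intervalIntegral.integral_mono_interval (by linarith) (by linarith) hr
        (Eventually.of_forall hF0) (hF _ _)
    have h2 : ∫ x in (-r)..r, u x ^ 2 ≤ A := by
      rw [intervalIntegral.integral_of_le (by linarith)]
      exact setIntegral_le_integral hui (Eventually.of_forall fun x => sq_nonneg _)
    have h3 : 0 ≤ ∫ x in (-r)..r, u x ^ 2 :=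
      intervalIntegral.integral_nonneg (by linarith) fun x _ => sq_nonneg _
    have h4 : l * ∫ x in (-r)..r, u x ^ 2 ≤ |l| * A :=
      (mul_le_mul_of_nonneg_right (le_abs_self l) h3).trans
        (mul_le_mul_of_nonneg_left h2 (abs_nonneg l))
    linarith
  have huz : Continuous fun x => u x * z x := hucont.mul h.isPrim_snd.continuous
  have hsu : Continuous fun x => c.s x * u x ^ 2 := c.continuous_s.mul (hucont.pow 2)
  have huz' : Continuous fun x => u (-x) * z (-x) := huz.comp continuous_neg
  have hsplit : ∀ a b : ℝ, ∫ x in a..b, (2 * (u x * z x) - 2 * (c.s x * u x ^ 2)) =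
      2 * (∫ x in a..b, u x * z x) - 2 * ∫ x in a..b, c.s x * u x ^ 2 := fun a b => by
    rw [← intervalIntegral.integral_const_mul, ← intervalIntegral.integral_const_mul]
    exact intervalIntegral.integral_sub ((huz.intervalIntegrable _ _).const_mul 2)
      ((hsu.intervalIntegrable _ _).const_mul 2)
  -- As `(u²)' = 2 u z - 2 s u²`, integrating the boundary bound makes `u(R)² + u(-R)²` grow
  -- linearly, up to an error bounded by `‖u‖²`. This contradicts square integrability.
  have hk : ∀ R, R₀ ≤ R → 2 * (R - R₀) - 4 * (c.C * A) ≤ u R ^ 2 + u (-R) ^ 2 := fun R hR => by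
    have h1 := h.isPrim_sq.2 R₀ R
    have h2 := h.isPrim_sq.2 (-R) (-R₀)
    rw [hsplit] at h1 h2
    have h3 := (abs_le.1 (c.abs_integral_s_mul_sq_le hu hR)).2
    have h4 := (abs_le.1 (c.abs_integral_s_mul_sq_le hu (neg_le_neg hR))).1
    rw [← intervalIntegral.integral_comp_neg (fun x => u x * z x)] at h2
    have h5 : R - R₀ ≤ (∫ x in R₀..R, u x * z x) - ∫ x in R₀..R, u (-x) * z (-x) := by
      rw [← intervalIntegral.integral_sub (huz.intervalIntegrable _ _)
        (huz'.intervalIntegrable _ _)]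
      have h6 : ∫ x in R₀..R, (1 : ℝ) ≤
          ∫ x in R₀..R, (u x * z x - u (-x) * z (-x)) :=
        intervalIntegral.integral_mono_on hR intervalIntegrable_const
          ((huz.sub huz').intervalIntegrable _ _) fun x hx => hP x hx.1
      simpa using h6
    nlinarith [sq_nonneg (u R₀), sq_nonneg (u (-R₀))]
  have hki : Integrable (fun R => u R ^ 2 + u (-R) ^ 2) := hui.add hui.comp_neg
  set R₁ := R₀ + 2 * (c.C * A) + 1 with hR₁
  have hCA := mul_nonneg c.C_nonneg hA0
  have hone : IntegrableOn (fun _ => (1 : ℝ)) (Set.Ioi R₁) := by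
    refine hki.integrableOn.mono' aestronglyMeasurable_const ?_
    rw [ae_restrict_iff' measurableSet_Ioi]
    refine Eventually.of_forall fun R hR => ?_
    have hR' : R₁ < R := hR
    have := hk R (by linarith)
    rw [norm_one]
    linarith
  rw [integrableOn_const_iff (by simp)] at hone
  simp at hone

/-- Square integrable solutions have finite energy. -/
lemma hasEnergy (h : c.IsSol l u z) (hu : MemLp u 2 volume) : c.HasEnergy u z := by
  have hF0 : ∀ x, 0 ≤ z x ^ 2 + c.m x * u x ^ 2 := fun x =>
    add_nonneg (sq_nonneg _) (mul_nonneg (c.m_pos x).le (sq_nonneg _))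
  have hint : Integrable (fun x => z x ^ 2 + c.m x * u x ^ 2) := by
    refine integrable_of_intervalIntegral_norm_bounded (|l| * (∫ x, u x ^ 2) + 1)
      (a := fun n : ℕ => -(n : ℝ)) (b := fun n : ℕ => (n : ℝ)) (l := atTop)
      (fun n => (h.locallyIntegrable_energy.integrableOn_isCompact isCompact_Icc).mono_set
        Set.Ioc_subset_Icc_self)
      (tendsto_neg_atTop_atBot.comp tendsto_natCast_atTop_atTop) tendsto_natCast_atTop_atTop
      (Eventually.of_forall fun n => ?_)
    simp only [Real.norm_of_nonneg (hF0 _)]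
    exact h.energy_le hu (Nat.cast_nonneg n)
  refine ⟨h.isPrim_fst, ?_, ?_⟩
  · rw [memLp_two_iff_integrable_sq h.isPrim_snd.continuous.aestronglyMeasurable]
    refine hint.mono' (h.isPrim_snd.continuous.pow 2).aestronglyMeasurable
      (Eventually.of_forall fun x => ?_)
    rw [Real.norm_of_nonneg (sq_nonneg _)]
    exact le_add_of_nonneg_right (mul_nonneg (c.m_pos x).le (sq_nonneg _))
  · have hmeas : AEStronglyMeasurable (fun x => Real.sqrt (c.m x) * u x) volume :=
      c.measurable_m.sqrt.aestronglyMeasurable.mul h.isPrim_fst.continuous.aestronglyMeasurable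
    rw [memLp_two_iff_integrable_sq hmeas]
    refine hint.mono' (hmeas.pow 2) (Eventually.of_forall fun x => ?_)
    rw [Real.norm_of_nonneg (sq_nonneg _), mul_pow, Real.sq_sqrt (c.m_pos x).le]
    exact le_add_of_nonneg_left (sq_nonneg _)

/-- The Wronskian of two square integrable solutions vanishes. -/
lemma wronskian_eq_zero (h₁ : c.IsSol l u₁ z₁) (h₂ : c.IsSol l u₂ z₂) (hu₁ : MemLp u₁ 2 volume)
    (hu₂ : MemLp u₂ 2 volume) (x : ℝ) : u₁ x * z₂ x - u₂ x * z₁ x = 0 := by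
  have hW : IsPrim (fun x => u₁ x * z₂ x - u₂ x * z₁ x) (fun _ => 0) :=
    ((h₁.isPrim_fst.mul h₂.isPrim_snd).sub (h₂.isPrim_fst.mul h₁.isPrim_snd)).congr
      (fun _ => rfl) (Eventually.of_forall fun x => by ring)
  have hi : Integrable (fun x => u₁ x * z₂ x - u₂ x * z₁ x) :=
    (integrable_mul_of_memLp hu₁ (h₂.hasEnergy hu₂).memLp_deriv).sub
      (integrable_mul_of_memLp hu₂ (h₁.hasEnergy hu₁).memLp_deriv)
  -- An integrable constant on the line is zero; integrability rests on `z₁` and `z₂` being in L²,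
  -- by finite energy.
  have hi' : Integrable (fun _ : ℝ => u₁ x * z₂ x - u₂ x * z₁ x) :=
    hi.congr (Eventually.of_forall fun y => hW.eq_const y x)
  rw [integrable_const_iff] at hi'
  refine hi'.resolve_right fun h => ?_
  simpa using h.measure_univ_lt_top

/-- The vanishing Wronskian makes the Cauchy data at 0 proportional, and uniqueness spreads this
over the line. The factor is read off from `u` or, if `u₁ 0 = 0`, from `z`. -/
lemma exists_eq_mul (h₁ : c.IsSol l u₁ z₁) (h₂ : c.IsSol l u₂ z₂) (hu₁ : MemLp u₁ 2 volume)
    (hu₂ : MemLp u₂ 2 volume) (hne : ∃ x, u₁ x ≠ 0) : ∃ a : ℝ, ∀ x, u₂ x = a * u₁ x := by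
  have hw := h₁.wronskian_eq_zero h₂ hu₁ hu₂ 0
  have key : ∀ a : ℝ, u₂ 0 - a * u₁ 0 = 0 → z₂ 0 - a * z₁ 0 = 0 → ∀ x, u₂ x = a * u₁ x :=
    fun a ha hb x => sub_eq_zero.1 ((h₁.sub_const_mul h₂ a).eq_zero ha hb x)
  by_cases h0 : u₁ 0 = 0
  · have hz : z₁ 0 ≠ 0 := fun hz => by
      obtain ⟨x, hx⟩ := hne
      exact hx (h₁.eq_zero h0 hz x)
    refine ⟨z₂ 0 / z₁ 0, key _ ?_ (by field_simp; ring)⟩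
    rw [h0] at hw ⊢
    have : u₂ 0 = 0 := by
      have : u₂ 0 * z₁ 0 = 0 := by linarith
      exact (mul_eq_zero.1 this).resolve_right hz
    rw [this]; ring
  · refine ⟨u₂ 0 / u₁ 0, key _ (by field_simp; ring) ?_⟩
    field_simp
    linarith

/-- A square integrable solution satisfies the weak eigenvalue equation on the form domain. -/
lemma exists_isFormEigenvector (h : c.IsSol l u z) (hu : MemLp u 2 volume) (hne : ∃ x, u x ≠ 0) :
    ∃ x, IsFormEigenvector c.J l x ∧ c.J x =ᵐ[volume] u := by
  have hE := h.hasEnergy hu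
  obtain ⟨x, hfst, hsnd, hJ⟩ := hE.exists_mem
  refine ⟨x, ⟨fun h0 => ?_, fun y => ?_⟩, hJ⟩
  · have h1 : u =ᵐ[volume] fun _ => 0 := by
      refine hJ.symm.trans ?_
      rw [h0, map_zero]
      exact Lp.coeFn_zero _ _ _
    obtain ⟨t, ht⟩ := hne
    exact ht (congrFun ((Continuous.ae_eq_iff_eq volume h.isPrim_fst.continuous
      continuous_const).1 h1) t)
  · obtain ⟨v, g, hE', hfst', hsnd', hJ'⟩ := c.exists_hasEnergy y
    rw [c.inner_eq hfst hfst' hsnd hsnd', L2R.inner_eq_of_ae hJ hJ']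
    have hi1 := integrable_mul_of_memLp hE.memLp_deriv hE'.memLp_deriv
    have hi2 : Integrable fun t => c.m t * (u t * v t) := by
      refine (integrable_mul_of_memLp hE.memLp_weight hE'.memLp_weight).congr
        (Eventually.of_forall fun t => ?_)
      simp only
      nth_rewrite 3 [← Real.mul_self_sqrt (c.m_pos t).le]
      ring
    have hi3 := integrable_mul_of_memLp hu hE'.memLp
    -- The weak equation is the statement that the derivative of `z v` has integral zero; no
    -- boundary terms arise since both are integrable.
    have hP : IsPrim (fun t => z t * v t)
        (fun t => z t * g t + c.m t * (u t * v t) - l * (u t * v t)) :=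
      (h.isPrim_snd.mul hE'.isPrim).congr (fun _ => rfl) (Eventually.of_forall fun t => by ring)
    have h0 := hP.integral_eq_zero (integrable_mul_of_memLp hE.memLp_deriv hE'.memLp)
      ((hi1.add hi2).sub (hi3.const_mul l))
    have h1 : ∫ t, (z t * g t + c.m t * (u t * v t) - l * (u t * v t)) =
        ((∫ t, z t * g t) + ∫ t, c.m t * (u t * v t)) - l * ∫ t, u t * v t := by
      rw [← integral_add hi1 hi2, ← integral_const_mul]
      exact integral_sub (hi1.add hi2) (hi3.const_mul l)
    linarith

end IsSol

/-- Form eigenvectors are represented by square integrable solutions. -/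
lemma exists_isSol {x : c.space} (hx : IsFormEigenvector c.J l x) :
    ∃ u z, c.IsSol l u z ∧ MemLp u 2 volume ∧ c.J x =ᵐ[volume] u ∧ ∃ t, u t ≠ 0 := by
  obtain ⟨v, g, hE, hfst, hsnd, hJ⟩ := c.exists_hasEnergy x
  have hgl := memLp_locallyIntegrable hE.memLp_deriv
  have hvc := hE.isPrim.continuous
  have hsg : LocallyIntegrable (fun t => c.s t * g t) volume := hgl.continuous_mul c.continuous_s
  have hmv : LocallyIntegrable (fun t => (c.m t - l) * v t) volume := by
    have h1 : LocallyIntegrable (fun x => c.m x - l) volume :=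
      c.locallyIntegrable_m.sub (continuous_const (y := l)).locallyIntegrable
    simpa only [mul_comm] using h1.continuous_mul hvc
  -- Testing the form equation with smooth `φ` identifies the weak derivative of `g = v' + s v`,
  -- which is the second equation of the system.
  obtain ⟨z, hz, hgz⟩ := exists_isPrim_ae_eq hgl (hsg.add hmv) fun φ hφ => by
    obtain ⟨y, hfst', hsnd', hJ'⟩ := (IsTest.hasEnergy (c := c) hφ).exists_mem
    have h1 := hx.2 y
    rw [c.inner_eq hfst hfst' hsnd hsnd', L2R.inner_eq_of_ae hJ hJ'] at h1
    have hi1 : Integrable fun t => g t * deriv φ t := hφ.deriv.integrable_mul hgl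
    have hi2 : Integrable fun t => c.s t * g t * φ t := hφ.integrable_mul hsg
    have hi3 : Integrable fun t => (c.m t - l) * v t * φ t := hφ.integrable_mul hmv
    have hi4 : Integrable fun t => v t * φ t := hφ.integrable_mul hvc.locallyIntegrable
    have h2 : ∫ t, g t * (deriv φ t + c.s t * φ t) =
        (∫ t, g t * deriv φ t) + ∫ t, c.s t * g t * φ t := by
      rw [← integral_add hi1 hi2]
      exact integral_congr_ae (Eventually.of_forall fun t => by ring)
    have h3 : ∫ t, c.m t * (v t * φ t) =
        (∫ t, (c.m t - l) * v t * φ t) + l * ∫ t, v t * φ t := by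
      rw [← integral_const_mul, ← integral_add hi3 (hi4.const_mul l)]
      exact integral_congr_ae (Eventually.of_forall fun t => by ring)
    have h4 : ∫ t, ((fun t => c.s t * g t) + fun t => (c.m t - l) * v t) t * φ t =
        (∫ t, c.s t * g t * φ t) + ∫ t, (c.m t - l) * v t * φ t := by
      rw [← integral_add hi2 hi3]
      exact integral_congr_ae (Eventually.of_forall fun t => by
        simp only [Pi.add_apply]; ring)
    rw [h4]
    linarith
  refine ⟨v, z, ⟨hE.isPrim.congr (fun _ => rfl) (hgz.mono fun t ht => by simp only [ht]),
    hz.congr (fun _ => rfl) (hgz.mono fun t ht => by simp only [Pi.add_apply, ht])⟩,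
    hE.memLp, hJ, ?_⟩
  by_contra hcon
  push Not at hcon
  refine hx.1 (c.injective_J ?_)
  rw [map_zero]
  ext1
  exact (hJ.trans (Eventually.of_forall hcon)).trans (Lp.coeFn_zero _ _ _).symm

lemma mem_formSpectrum_iff : l ∈ formSpectrum c.J ↔
    ∃ u z, c.IsSol l u z ∧ MemLp u 2 volume ∧ ∃ t, u t ≠ 0 := by
  constructor
  · rintro ⟨x, hx⟩
    obtain ⟨u, z, h, hu, -, hne⟩ := exists_isSol hx
    exact ⟨u, z, h, hu, hne⟩
  · rintro ⟨u, z, h, hu, hne⟩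
    obtain ⟨x, hx, -⟩ := h.exists_isFormEigenvector hu hne
    exact ⟨x, hx⟩

lemma hasSimpleFormSpectrum : HasSimpleFormSpectrum c.J := by
  intro l x y hx hy
  obtain ⟨u₁, z₁, h₁, hu₁, hJ₁, hne⟩ := exists_isSol hx
  obtain ⟨u₂, z₂, h₂, hu₂, hJ₂, -⟩ := exists_isSol hy
  obtain ⟨a, ha⟩ := h₁.exists_eq_mul h₂ hu₁ hu₂ hne
  refine ⟨a, c.injective_J ?_⟩
  rw [map_smul]
  ext1
  filter_upwards [hJ₁, hJ₂, Lp.coeFn_smul a (c.J x)] with t h1 h2 h3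
  rw [h2, h3, Pi.smul_apply, h1, ha, smul_eq_mul]

end FormCoeff

end Solutions

open Filter Topology

/-! ### Matching operator eigenvalues with form eigenvalues, and transferring the comparison. -/

section Eigenvalues

/-- Local square integrability. -/
def IsLocL2 (W : ℝ → ℝ) : Prop := ∀ K : Set ℝ, IsCompact K → MemLp W 2 (volume.restrict K)

namespace IsLocL2

variable {W V : ℝ → ℝ}

lemma of_continuous (hW : Continuous W) : IsLocL2 W := fun K hK => by
  obtain ⟨C, hC⟩ := hK.exists_bound_of_continuousOn hW.continuousOn
  have : IsFiniteMeasure (volume.restrict K) := ⟨by simpa using hK.measure_lt_top⟩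
  refine (memLp_const C).of_le hW.aestronglyMeasurable ?_
  rw [ae_restrict_iff' hK.measurableSet]
  exact Eventually.of_forall fun x hx => (hC x hx).trans (le_abs_self C)

lemma of_memLp (hW : MemLp W 2 volume) : IsLocL2 W := fun _ _ => hW.restrict _

lemma of_memLp_top (hW : MemLp W ⊤ volume) : IsLocL2 W := fun K hK => by
  have : IsFiniteMeasure (volume.restrict K) := ⟨by simpa using hK.measure_lt_top⟩
  exact (hW.restrict K).mono_exponent le_top

lemma add (hW : IsLocL2 W) (hV : IsLocL2 V) : IsLocL2 (fun x => W x + V x) :=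
  fun K hK => (hW K hK).add (hV K hK)

lemma sub (hW : IsLocL2 W) (hV : IsLocL2 V) : IsLocL2 (fun x => W x - V x) :=
  fun K hK => (hW K hK).sub (hV K hK)

lemma congr (hW : IsLocL2 W) (h : W =ᵐ[volume] V) : IsLocL2 V :=
  fun K hK => (hW K hK).ae_eq (ae_restrict_of_ae h)

lemma locallyIntegrable (hW : IsLocL2 W) : LocallyIntegrable W volume :=
  locallyIntegrable_iff.2 fun K hK => by
    have : IsFiniteMeasure (volume.restrict K) := ⟨by simpa using hK.measure_lt_top⟩
    exact (hW K hK).integrable (by norm_num)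

lemma aestronglyMeasurable (hW : IsLocL2 W) : AEStronglyMeasurable W volume :=
  hW.locallyIntegrable.aestronglyMeasurable

lemma locallyIntegrable_mul (hW : IsLocL2 W) (hV : IsLocL2 V) :
    LocallyIntegrable (fun x => W x * V x) volume :=
  locallyIntegrable_iff.2 fun K hK => (hW K hK).integrable_mul (hV K hK)

lemma memLp_mul (hW : IsLocL2 W) {φ : ℝ → ℝ} (hφ : IsTest φ) :
    MemLp (fun x => W x * φ x) 2 volume := by
  set K := tsupport φ
  have hK : IsCompact K := hφ.2.isCompact
  obtain ⟨C, hC⟩ := hφ.continuous.bounded_above_of_compact_support hφ.2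
  have h1 : (fun x => W x * φ x) = K.indicator (fun x => W x * φ x) := by
    ext x
    by_cases hx : x ∈ K
    · rw [Set.indicator_of_mem hx]
    · rw [Set.indicator_of_notMem hx, image_eq_zero_of_notMem_tsupport hx, mul_zero]
  rw [h1, memLp_indicator_iff_restrict hK.measurableSet]
  refine ((hW K hK).const_mul C).of_le
    ((hW K hK).aestronglyMeasurable.mul hφ.continuous.aestronglyMeasurable)
    (Eventually.of_forall fun x => ?_)
  rw [norm_mul, norm_mul, mul_comm]
  exact mul_le_mul_of_nonneg_right ((hC x).trans (le_abs_self C)) (norm_nonneg _)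

end IsLocL2

variable {B p : ℝ}

/-- The potential `(p + B x)² + v` equals `m + s² - s' - k`. -/
structure FormCoeff.Represents (c : FormCoeff B p) (k : ℝ) (v : ℝ → ℝ) : Prop where
  isLocL2 : IsLocL2 v
  eq : ∀ᵐ x, (p + B * x) ^ 2 + v x = c.m x - k + c.s x ^ 2 - c.s' x

/-- The weak form of `-r'' + W r = E r`. -/
def IsWeakSol (W : ℝ → ℝ) (E : ℝ) (r : ℝ → ℝ) : Prop :=
  ∀ φ, IsTest φ → ∫ x, r x * (-deriv (deriv φ) x + W x * φ x) = E * ∫ x, r x * φ x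

lemma integral_weak_eq {W : ℝ → ℝ} (hW : IsLocL2 W) {r : ℝ → ℝ} (hr : IsLocL2 r) (E : ℝ)
    {φ : ℝ → ℝ} (hφ : IsTest φ) :
    ∫ x, r x * (-deriv (deriv φ) x + W x * φ x) =
      (∫ x, (W x - E) * r x * φ x) - (∫ x, r x * deriv (deriv φ) x) + E * ∫ x, r x * φ x := by
  have hi1 : Integrable fun x => (W x - E) * r x * φ x :=
    hφ.integrable_mul ((hW.sub (.of_continuous continuous_const)).locallyIntegrable_mul hr)
  have hi2 : Integrable fun x => r x * deriv (deriv φ) x :=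
    hφ.deriv.deriv.integrable_mul hr.locallyIntegrable
  have hi3 : Integrable fun x => r x * φ x := hφ.integrable_mul hr.locallyIntegrable
  rw [← integral_const_mul, ← integral_sub hi1 hi2]
  refine Eq.trans (integral_congr_ae (Eventually.of_forall fun x => ?_))
    (integral_add (hi1.sub hi2) (hi3.const_mul E))
  simp only
  ring

namespace FormCoeff

variable {c : FormCoeff B p} {k : ℝ} {v : ℝ → ℝ}

lemma Represents.isLocL2_potential (h : c.Represents k v) :
    IsLocL2 (fun x => (p + B * x) ^ 2 + v x) :=
  (IsLocL2.of_continuous (by fun_prop)).add h.isLocL2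

/-- Weak solutions are regular. -/
lemma Represents.exists_isSol (h : c.Represents k v) {E : ℝ} {r : ℝ → ℝ} (hr : IsLocL2 r)
    (hw : IsWeakSol (fun x => (p + B * x) ^ 2 + v x) E r) :
    ∃ u z, c.IsSol (E + k) u z ∧ r =ᵐ[volume] u := by
  set W : ℝ → ℝ := fun x => (p + B * x) ^ 2 + v x with hWdef
  have hW : IsLocL2 W := h.isLocL2_potential
  have hq : LocallyIntegrable (fun x => (W x - E) * r x) volume :=
    (hW.sub (.of_continuous continuous_const)).locallyIntegrable_mul hr
  have hZ := IsPrim.primitive hq 0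
  have hU := IsPrim.primitive hZ.continuous.locallyIntegrable 0
  set Z : ℝ → ℝ := fun x => ∫ t in (0 : ℝ)..x, (W t - E) * r t
  set U : ℝ → ℝ := fun x => ∫ t in (0 : ℝ)..x, Z t
  -- `U'' = (W - E) r` by construction, so `r - U` has zero second distributional derivative.
  obtain ⟨a, d, had⟩ := ae_eq_affine_of_integral_mul_deriv_deriv_eq_zero (r := fun x => r x - U x)
    (hr.locallyIntegrable.sub hU.continuous.locallyIntegrable) (fun φ hφ => by
      have h1 := hw φ hφ
      rw [integral_weak_eq hW hr E hφ] at h1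
      have h2 : ∫ x, U x * deriv (deriv φ) x = ∫ x, (W x - E) * r x * φ x := by
        rw [hφ.deriv.integral_mul_deriv hU, hφ.integral_mul_deriv hZ, neg_neg]
      simp only [sub_mul (r _)]
      rw [integral_sub (hφ.deriv.deriv.integrable_mul hr.locallyIntegrable)
        (hφ.deriv.deriv.integrable_mul hU.continuous.locallyIntegrable), h2]
      linarith)
  have hlin : IsPrim (fun x : ℝ => a + d * x) (fun _ => d) :=
    IsPrim.of_hasDerivAt (fun x => by simpa using ((hasDerivAt_id x).const_mul d).const_add a)
      continuous_const
  have hu := hU.add hlin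
  have hru : r =ᵐ[volume] fun x => U x + (a + d * x) := had.mono fun x hx => by
    simp only at hx
    linarith
  have hu1 := hZ.add (IsPrim.const d)
  refine ⟨fun x => U x + (a + d * x), fun x => (Z x + d) + c.s x * (U x + (a + d * x)),
    ⟨hu.congr (fun _ => rfl) (Eventually.of_forall fun x => by ring),
      (hu1.add (c.isPrim_s.mul hu)).congr (fun _ => rfl) ?_⟩, hru⟩
  filter_upwards [hru, h.eq] with x h1 h2
  have h3 : W x = c.m x - k + c.s x ^ 2 - c.s' x := h2
  rw [h1, h3]
  ring

/-- In the derivative of `u' = z - s u` the first order terms cancel and what remains is the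
potential minus `E`, times `u`; two integrations by parts conclude. -/
lemma IsSol.isWeakSol (h : c.Represents k v) {E : ℝ} {u z : ℝ → ℝ} (hs : c.IsSol (E + k) u z) :
    IsWeakSol (fun x => (p + B * x) ^ 2 + v x) E u := by
  intro φ hφ
  have hW := h.isLocL2_potential
  have hu1 : IsPrim (fun x => z x - c.s x * u x)
      (fun x => ((p + B * x) ^ 2 + v x - E) * u x) := by
    refine (hs.isPrim_snd.sub (c.isPrim_s.mul hs.isPrim_fst)).congr (fun _ => rfl) ?_
    filter_upwards [h.eq] with x hx
    rw [hx]
    ring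
  rw [integral_weak_eq hW (.of_continuous hs.isPrim_fst.continuous) E hφ,
    hφ.deriv.integral_mul_deriv hs.isPrim_fst, hφ.integral_mul_deriv hu1]
  ring

end FormCoeff

lemma deriv_ofReal_comp {φ : ℝ → ℝ} (hφ : Differentiable ℝ φ) :
    deriv (fun x => (φ x : ℂ)) = fun x => ((deriv φ x : ℝ) : ℂ) :=
  funext fun x => (hφ x).hasDerivAt.ofReal_comp.deriv

lemma fiberExpr_ofReal {φ : ℝ → ℝ} (hφ : IsTest φ) (v : ℝ → ℝ) (x : ℝ) :
    fiberExpr B p v (fun x => (φ x : ℂ)) x =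
      ((-deriv (deriv φ) x + ((p + B * x) ^ 2 + v x) * φ x : ℝ) : ℂ) := by
  rw [fiberExpr, deriv_ofReal_comp (hφ.1.differentiable (by simp)),
    deriv_ofReal_comp (hφ.deriv.1.differentiable (by simp))]
  push_cast
  ring

lemma isTest_clm_comp (L : ℂ →L[ℝ] ℝ) {f : ℝ → ℂ} (hf : ContDiff ℝ (⊤ : ℕ∞) f)
    (hc : HasCompactSupport f) : IsTest (fun x => L (f x)) :=
  ⟨L.contDiff.comp hf, hc.comp_left (map_zero L)⟩

lemma deriv_clm_comp (L : ℂ →L[ℝ] ℝ) {f : ℝ → ℂ} (hf : Differentiable ℝ f) :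
    deriv (fun x => L (f x)) = fun x => L (deriv f x) :=
  funext fun x => (L.hasFDerivAt.comp_hasDerivAt x (hf x).hasDerivAt).deriv

lemma clm_fiberExpr (L : ℂ →L[ℝ] ℝ) {f : ℝ → ℂ} (hf : ContDiff ℝ (⊤ : ℕ∞) f) (v : ℝ → ℝ) (x : ℝ) :
    L (fiberExpr B p v f x) = -deriv (deriv fun x => L (f x)) x +
      ((p + B * x) ^ 2 + v x) * L (f x) := by
  have h1 := contDiff_infty_iff_deriv.1 hf
  have h2 := contDiff_infty_iff_deriv.1 h1.2
  rw [fiberExpr, deriv_clm_comp L h1.1, deriv_clm_comp L h2.1, map_add, map_neg,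
    ← Complex.real_smul, map_smul, smul_eq_mul]

/-- The coefficients and `E` are real, so real linear functionals commute with the equation. This
reduces complex eigenfunctions to real ones. -/
lemma isWeakSol_clm_comp {W : ℝ → ℝ} {v : ℝ → ℝ} (hWv : W = fun x => (p + B * x) ^ 2 + v x)
    (hW : IsLocL2 W) {E : ℝ} {ψ : Lp ℂ 2 (volume : Measure ℝ)}
    (h : IsFiberImage B p v ψ ((E : ℂ) • ψ)) (L : ℂ →L[ℝ] ℝ) :
    IsWeakSol W E (fun x => L (ψ x)) := by
  intro φ hφ
  subst hWv
  have hf : ContDiff ℝ (⊤ : ℕ∞) (fun x => (φ x : ℂ)) := Complex.ofRealCLM.contDiff.comp hφ.1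
  have h1 := h (fun x => (φ x : ℂ)) hf (hφ.2.comp_left (g := Complex.ofReal) rfl)
  set q : ℝ → ℝ := fun x => -deriv (deriv φ) x + ((p + B * x) ^ 2 + v x) * φ x with hq
  have hqL : MemLp q 2 volume := hφ.deriv.deriv.memLp.neg.add (hW.memLp_mul hφ)
  have hqC : MemLp (fun x => (q x : ℂ)) 2 volume := hqL.ofReal
  have hφC : MemLp (fun x => (φ x : ℂ)) 2 volume := hφ.memLp.ofReal
  have hi1 : Integrable fun x => ψ x * (q x : ℂ) := (Lp.memLp ψ).integrable_mul hqC
  have hi2 : Integrable fun x => ψ x * (φ x : ℂ) := (Lp.memLp ψ).integrable_mul hφC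
  have h2 : ∫ x, ψ x * (q x : ℂ) = E * ∫ x, ψ x * (φ x : ℂ) := by
    rw [← integral_const_mul]
    refine (integral_congr_ae (Eventually.of_forall fun x => ?_)).trans
      (h1.trans (integral_congr_ae ?_))
    · simp only [fiberExpr_ofReal hφ, hq]
    · filter_upwards [Lp.coeFn_smul (E : ℂ) ψ] with x hx
      rw [hx, Pi.smul_apply, smul_eq_mul, mul_assoc]
  have hLmul : ∀ (y : ℂ) (t : ℝ), L (y * (t : ℂ)) = L y * t := fun y t => by
    rw [mul_comm, ← Complex.real_smul, map_smul, smul_eq_mul, mul_comm]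
  have h3 := congrArg L h2
  rw [← Complex.real_smul, map_smul, ← L.integral_comp_comm hi1, ← L.integral_comp_comm hi2,
    smul_eq_mul] at h3
  simpa only [hLmul] using h3

namespace FormCoeff

variable {c : FormCoeff B p} {k : ℝ} {v : ℝ → ℝ}

lemma Represents.mem_formSpectrum (h : c.Represents k v) {E : ℝ} (hE : E ∈ eigenvalues B p v) :
    E + k ∈ formSpectrum c.J := by
  obtain ⟨ψ, hψ0, hψ⟩ := hE
  have key : ∀ L : ℂ →L[ℝ] ℝ, ¬ ((fun x => L (ψ x)) =ᵐ[volume] fun _ => 0) →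
      E + k ∈ formSpectrum c.J := fun L hne => by
    have hL : MemLp (fun x => L (ψ x)) 2 volume := L.comp_memLp' (Lp.memLp ψ)
    obtain ⟨u, z, hs, hu⟩ := h.exists_isSol (IsLocL2.of_memLp hL)
      (isWeakSol_clm_comp rfl h.isLocL2_potential hψ L)
    refine mem_formSpectrum_iff.2 ⟨u, z, hs, hL.ae_eq hu, ?_⟩
    by_contra hcon
    push Not at hcon
    exact hne (hu.trans (Eventually.of_forall hcon))
  by_cases hre : (fun x => Complex.reCLM (ψ x)) =ᵐ[volume] fun _ => 0
  · refine key Complex.imCLM fun him => hψ0 ?_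
    ext1
    filter_upwards [hre, him, Lp.coeFn_zero ℂ 2 (volume : Measure ℝ)] with x h1 h2 h3
    rw [h3]
    exact Complex.ext h1 h2
  · exact key _ hre

lemma Represents.mem_eigenvalues (h : c.Represents k v) {E : ℝ}
    (hE : E + k ∈ formSpectrum c.J) : E ∈ eigenvalues B p v := by
  obtain ⟨u, z, hs, hu, t, ht⟩ := mem_formSpectrum_iff.1 hE
  have hW := h.isLocL2_potential
  have huC : MemLp (fun x => (u x : ℂ)) 2 volume := hu.ofReal
  refine ⟨huC.toLp _, fun h0 => ?_, fun f hf hc => ?_⟩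
  · have h1 : (fun x => (u x : ℂ)) =ᵐ[volume] fun _ => 0 := by
      refine huC.coeFn_toLp.symm.trans ?_
      rw [h0]
      exact Lp.coeFn_zero _ _ _
    have h2 := (Continuous.ae_eq_iff_eq volume
      (Complex.continuous_ofReal.comp hs.isPrim_fst.continuous) continuous_const).1 h1
    exact ht (Complex.ofReal_eq_zero.1 (congrFun h2 t))
  · have hweak := hs.isWeakSol h
    have hpart : ∀ L : ℂ →L[ℝ] ℝ, Integrable (fun x => u x * L (fiberExpr B p v f x)) ∧
        Integrable (fun x => u x * L (f x)) ∧
        ∫ x, u x * L (fiberExpr B p v f x) = E * ∫ x, u x * L (f x) := fun L => by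
      have hφ := isTest_clm_comp L hf hc
      simp only [clm_fiberExpr L hf]
      exact ⟨integrable_mul_of_memLp hu (hφ.deriv.deriv.memLp.neg.add (hW.memLp_mul hφ)),
        integrable_mul_of_memLp hu hφ.memLp, hweak _ hφ⟩
    have hsplit : ∀ y : ℝ → ℂ, Integrable (fun x => u x * Complex.reCLM (y x)) →
        Integrable (fun x => u x * Complex.imCLM (y x)) →
        ∫ x, (u x : ℂ) * y x = ((∫ x, u x * Complex.reCLM (y x) : ℝ) : ℂ) +
          ((∫ x, u x * Complex.imCLM (y x) : ℝ) : ℂ) * Complex.I := fun y h1 h2 => by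
      rw [← integral_complex_ofReal, ← integral_complex_ofReal, ← integral_mul_const,
        ← integral_add h1.ofReal (h2.ofReal.mul_const _)]
      refine integral_congr_ae (Eventually.of_forall fun x => ?_)
      simp only [Complex.reCLM_apply, Complex.imCLM_apply]
      nth_rewrite 1 [← Complex.re_add_im (y x)]
      push_cast
      ring
    obtain ⟨hr1, hr2, hr3⟩ := hpart Complex.reCLM
    obtain ⟨hi1, hi2, hi3⟩ := hpart Complex.imCLM
    have hl : ∫ x, huC.toLp _ x * fiberExpr B p v f x =
        ∫ x, (u x : ℂ) * fiberExpr B p v f x :=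
      integral_congr_ae (huC.coeFn_toLp.mono fun x hx => by simp only [hx])
    have hr : ∫ x, ((E : ℂ) • huC.toLp _) x * f x = E * ∫ x, (u x : ℂ) * f x := by
      rw [← integral_const_mul]
      refine integral_congr_ae ?_
      filter_upwards [huC.coeFn_toLp, Lp.coeFn_smul (E : ℂ) (huC.toLp _)] with x h1 h2
      rw [h2, Pi.smul_apply, h1, smul_eq_mul, mul_assoc]
    rw [hl, hr, hsplit _ hr1 hi1, hsplit _ hr2 hi2, hr3, hi3]
    push_cast
    ring

lemma Represents.eigenvalues_eq (h : c.Represents k v) :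
    eigenvalues B p v = (fun l => l - k) '' formSpectrum c.J := by
  ext E
  constructor
  · exact fun hE => ⟨E + k, h.mem_formSpectrum hE, add_sub_cancel_right E k⟩
  · rintro ⟨l, hl, rfl⟩
    exact h.mem_eigenvalues (by rwa [sub_add_cancel])

lemma Represents.eigenvalues_inter_Iic (h : c.Represents k v) (a : ℝ) :
    eigenvalues B p v ∩ Set.Iic a = (fun l => l - k) '' (formSpectrum c.J ∩ Set.Iic (a + k)) := by
  rw [h.eigenvalues_eq]
  ext E
  constructor
  · rintro ⟨⟨l, hl, rfl⟩, hle⟩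
    exact ⟨l, ⟨hl, by simpa [sub_le_iff_le_add] using hle⟩, rfl⟩
  · rintro ⟨l, ⟨hl, hle⟩, rfl⟩
    exact ⟨⟨l, hl, rfl⟩, by simpa [sub_le_iff_le_add] using hle⟩

lemma Represents.finite_eigenvalues (hB : 0 < B) (h : c.Represents k v) (a : ℝ) :
    (eigenvalues B p v ∩ Set.Iic a).Finite := by
  rw [h.eigenvalues_inter_Iic]
  exact (finite_formSpectrum_inter_Iic (c.isCompactOperator_J hB) _).image _

lemma Represents.infinite_eigenvalues (hB : 0 < B) (h : c.Represents k v) :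
    (eigenvalues B p v).Infinite := by
  rw [h.eigenvalues_eq]
  exact (infinite_formSpectrum (c.isCompactOperator_J hB) c.injective_J c.hasSimpleFormSpectrum
    c.not_finiteDimensional_space).image (sub_left_injective.injOn)

/-- The inclusion of the form domain for a larger weight into that for a smaller weight. -/
lemma exists_inclusion (c₁ c₂ : FormCoeff B p) (hs : c₁.s = c₂.s) (hm : ∀ x, c₁.m x ≤ c₂.m x) :
    ∃ i : c₂.space →ₗ[ℝ] c₁.space, (∀ x, ‖i x‖ ≤ ‖x‖) ∧ ∀ x, c₁.J (i x) = c₂.J x := by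
  -- The inclusion is `v ↦ v`. In the coordinate `√m v` it multiplies by `√(m₁ / m₂) ≤ 1`; the
  -- coordinate `v' + s v` is unchanged since `s` is common.
  set ρ : ℝ → ℝ := fun x => Real.sqrt (c₁.m x) * c₂.w x with hρ
  have hρm : Measurable ρ := c₁.measurable_m.sqrt.mul c₂.measurable_w
  have hρ1 : ∀ x, |ρ x| ≤ 1 := fun x => by
    rw [abs_of_nonneg (mul_nonneg (Real.sqrt_nonneg _) (c₂.w_pos x).le)]
    simp only [w, ← div_eq_mul_inv]
    exact div_le_one_of_le₀ (Real.sqrt_le_sqrt (hm x)) (Real.sqrt_nonneg _)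
  let A : WithLp 2 (L2R × L2R) →ₗ[ℝ] WithLp 2 (L2R × L2R) :=
    { toFun := fun x => WithLp.toLp 2 (x.fst, mulL2 ρ hρm hρ1 x.snd)
      map_add' := fun x y => by
        refine WithLp.ofLp_injective 2 (Prod.ext rfl ?_)
        exact map_add _ _ _
      map_smul' := fun a x => by
        refine WithLp.ofLp_injective 2 (Prod.ext rfl ?_)
        exact map_smul _ _ _ }
  have hproj : ∀ x, c₁.proj (A x) = c₂.proj x := fun x => by
    ext1
    filter_upwards [c₁.coeFn_proj (A x), c₂.coeFn_proj x, coeFn_mulL2 hρm hρ1 x.snd]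
      with t h1 h2 h3
    have h4 : (A x).snd t = ρ t * x.snd t := h3
    rw [h1, h2, h4, ← mul_assoc]
    simp only [hρ]
    rw [← mul_assoc, mul_comm (c₁.w t), c₁.sqrt_m_mul_w, one_mul]
  have hmem : ∀ x : c₂.space, A x.1 ∈ c₁.space := fun x => by
    rw [mem_space_iff]
    intro φ hφ
    rw [hproj, hs]
    exact (c₂.mem_space_iff x.1).1 x.2 φ hφ
  refine ⟨(A.comp c₂.space.subtype).codRestrict c₁.space hmem, fun x => ?_, fun x => hproj x.1⟩
  change ‖A x.1‖ ≤ ‖x.1‖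
  rw [← sq_le_sq₀ (norm_nonneg _) (norm_nonneg _), WithLp.prod_norm_sq_eq_of_L2,
    WithLp.prod_norm_sq_eq_of_L2]
  exact add_le_add le_rfl (pow_le_pow_left₀ (norm_nonneg _) (norm_mulL2_le hρm hρ1 _) 2)

lemma ncard_eigenvalues_le (hB : 0 < B) {c₁ c₂ : FormCoeff B p} {v₁ v₂ : ℝ → ℝ}
    (h₁ : c₁.Represents k v₁) (h₂ : c₂.Represents k v₂) (hs : c₁.s = c₂.s)
    (hm : ∀ x, c₁.m x ≤ c₂.m x) (a : ℝ) :
    (eigenvalues B p v₂ ∩ Set.Iic a).ncard ≤ (eigenvalues B p v₁ ∩ Set.Iic a).ncard := by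
  obtain ⟨i, hi, hiJ⟩ := exists_inclusion c₁ c₂ hs hm
  rw [h₁.eigenvalues_inter_Iic, h₂.eigenvalues_inter_Iic,
    Set.ncard_image_of_injective _ sub_left_injective,
    Set.ncard_image_of_injective _ sub_left_injective]
  exact ncard_formSpectrum_le (c₁.isCompactOperator_J hB) c₁.hasSimpleFormSpectrum
    (c₂.isCompactOperator_J hB) i hi hiJ _

end FormCoeff

end Eigenvalues

open Filter Topology

/-! ### Representing admissible potentials by form coefficients. -/

section Admissible

/-- Every square integrable function is the derivative of a bounded function, up to a bounded
error. -/
lemma exists_isPrim_bounded {f : ℝ → ℝ} (hf : MemLp f 2 volume) :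
    ∃ (s b : ℝ → ℝ) (C : ℝ), IsPrim s (fun x => f x - b x * s x) ∧ Continuous b ∧
      (∀ x, |b x| ≤ 1) ∧ ∀ x, |s x| ≤ C := by
  have hcoshne : ∀ x : ℝ, Real.cosh x ≠ 0 := fun x => (Real.cosh_pos x).ne'
  have hsinh : ∀ x : ℝ, |Real.sinh x| ≤ Real.cosh x := fun x =>
    abs_le.2 ⟨by linarith [Real.exp_pos x, Real.sinh_add_cosh x], (Real.sinh_lt_cosh x).le⟩
  have hfl : LocallyIntegrable (fun x => Real.cosh x * f x) volume :=
    (memLp_locallyIntegrable hf).continuous_mul Real.continuous_cosh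
  have hP := IsPrim.primitive hfl 0
  set P : ℝ → ℝ := fun x => ∫ t in (0 : ℝ)..x, Real.cosh t * f t
  have hbc : Continuous fun x => Real.sinh x / Real.cosh x :=
    Real.continuous_sinh.div Real.continuous_cosh hcoshne
  have hinv : IsPrim (fun x => (Real.cosh x)⁻¹) (fun x => -Real.sinh x / Real.cosh x ^ 2) :=
    IsPrim.of_hasDerivAt (fun x => (Real.hasDerivAt_cosh x).inv (hcoshne x))
      (Real.continuous_sinh.neg.div (Real.continuous_cosh.pow 2) fun x => pow_ne_zero 2 (hcoshne x))
  -- This solves `s' + tanh(x) s = f` with integrating factor `cosh`.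
  refine ⟨fun x => (Real.cosh x)⁻¹ * P x, fun x => Real.sinh x / Real.cosh x,
    (1 + ∫ t, f t ^ 2) / 2, (hinv.mul hP).congr (fun _ => rfl) (Eventually.of_forall fun x => ?_),
    hbc, fun x => ?_, fun x => ?_⟩
  · have := hcoshne x
    field_simp
    ring
  · rw [abs_div, abs_of_pos (Real.cosh_pos x)]
    exact div_le_one_of_le₀ (hsinh x) (Real.cosh_pos x).le
  · have hfi := hf.integrable_sq
    -- From `|f| ≤ (1 + f²) / 2` and `cosh t ≤ cosh x`. The right side is at most `cosh x (1 + ∫ f²)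
    -- / 2`, whence the value of `C`.
    have hle : ‖P x‖ ≤ |∫ t in (0 : ℝ)..x, (Real.cosh t + Real.cosh x * f t ^ 2) / 2| := by
      refine intervalIntegral.norm_integral_le_abs_of_norm_le ?_
        (((Real.continuous_cosh.intervalIntegrable _ _).add
          (hfi.intervalIntegrable.const_mul _)).div_const 2)
      rw [ae_restrict_iff' measurableSet_uIoc]
      refine Eventually.of_forall fun t ht => ?_
      have htx : Real.cosh t ≤ Real.cosh x := by
        rw [Real.cosh_le_cosh]
        simpa using Set.abs_sub_left_of_mem_uIcc (Set.uIoc_subset_uIcc ht)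
      have ht0 := Real.cosh_pos t
      rw [norm_mul, Real.norm_of_nonneg ht0.le, Real.norm_eq_abs, ← sq_abs (f t)]
      nlinarith [mul_nonneg ht0.le (sq_nonneg (|f t| - 1)),
        mul_nonneg (sub_nonneg.2 htx) (sq_nonneg |f t|)]
    have h0 : |∫ t in (0 : ℝ)..x, f t ^ 2| ≤ ∫ t, f t ^ 2 := by
      rw [← Real.norm_eq_abs, intervalIntegral.norm_integral_eq_norm_integral_uIoc,
        Real.norm_of_nonneg (integral_nonneg fun t => sq_nonneg _)]
      exact setIntegral_le_integral hfi (Eventually.of_forall fun t => sq_nonneg _)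
    have hval : ∫ t in (0 : ℝ)..x, (Real.cosh t + Real.cosh x * f t ^ 2) / 2 =
        (Real.sinh x + Real.cosh x * ∫ t in (0 : ℝ)..x, f t ^ 2) / 2 := by
      have hcs : ∫ t in (0 : ℝ)..x, Real.cosh t = Real.sinh x := by
        rw [intervalIntegral.integral_eq_sub_of_hasDerivAt (fun t _ => Real.hasDerivAt_sinh t)
          (Real.continuous_cosh.intervalIntegrable _ _), Real.sinh_zero, sub_zero]
      rw [intervalIntegral.integral_div, intervalIntegral.integral_add
        (Real.continuous_cosh.intervalIntegrable _ _) (hfi.intervalIntegrable.const_mul _),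
        intervalIntegral.integral_const_mul, hcs]
    rw [hval, Real.norm_eq_abs] at hle
    rw [abs_mul, abs_inv, abs_of_pos (Real.cosh_pos x), inv_mul_le_iff₀ (Real.cosh_pos x)]
    refine hle.trans ?_
    rw [abs_div, abs_two]
    have h1 := abs_add_le (Real.sinh x) (Real.cosh x * ∫ t in (0 : ℝ)..x, f t ^ 2)
    rw [abs_mul, abs_of_pos (Real.cosh_pos x)] at h1
    have h2 := mul_le_mul_of_nonneg_left h0 (Real.cosh_pos x).le
    linarith [hsinh x]

variable {v v₁ v₂ : ℝ → ℝ}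

lemma Admissible.isLocL2 (h : Admissible v) : IsLocL2 v := by
  obtain ⟨f, g, hf, hg, hfg⟩ := h.negPart_L2_add_Linfty
  have h1 : IsLocL2 (fun x => max (-v x) 0) :=
    ((IsLocL2.of_memLp hf).add (IsLocL2.of_memLp_top hg)).congr hfg.symm
  have h2 : IsLocL2 (fun x => max (v x) 0) := h.posPart_locL2
  refine (h2.sub h1).congr (Eventually.of_forall fun x => ?_)
  simp only
  rcases le_total (v x) 0 with h0 | h0
  · rw [max_eq_right h0, max_eq_left (by linarith)]; ring
  · rw [max_eq_left h0, max_eq_right (by linarith)]; ring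

/-- Weights must be measurable and ordered at every point, while the potentials are controlled only
almost everywhere; taking a maximum with `l` repairs a null set. -/
lemma exists_measurable_ge {M l : ℝ → ℝ} (hM : AEStronglyMeasurable M volume) (hl : Measurable l)
    (hle : ∀ᵐ x, l x ≤ M x) :
    ∃ m : ℝ → ℝ, Measurable m ∧ (∀ x, l x ≤ m x) ∧ m =ᵐ[volume] M := by
  refine ⟨fun x => max (l x) (hM.mk M x), hl.max hM.stronglyMeasurable_mk.measurable,
    fun x => le_max_left _ _, ?_⟩
  filter_upwards [hM.ae_eq_mk, hle] with x h1 h2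
  rw [← h1, max_eq_right h2]

/-- Two ordered admissible potentials are represented by ordered weights, with the same first order
coefficient. -/
lemma exists_represents (B p : ℝ) (h₁ : Admissible v₁) (h₂ : Admissible v₂)
    (h : ∀ᵐ x, v₁ x ≤ v₂ x) :
    ∃ (c₁ c₂ : FormCoeff B p) (k : ℝ), c₁.Represents k v₁ ∧ c₂.Represents k v₂ ∧
      c₁.s = c₂.s ∧ ∀ x, c₁.m x ≤ c₂.m x := by
  obtain ⟨f, g, hf, hg, hfg⟩ := h₁.negPart_L2_add_Linfty
  obtain ⟨s, b, C, hs, hb, hb1, hC⟩ := exists_isPrim_bounded hf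
  obtain ⟨G, hG⟩ : ∃ G : ℝ, ∀ᵐ x, |g x| ≤ G := by
    have hg' : eLpNormEssSup g volume < ⊤ := by simpa using hg.eLpNorm_lt_top
    refine ⟨(eLpNormEssSup g volume).toReal, ?_⟩
    filter_upwards [enorm_ae_le_eLpNormEssSup g volume] with x hx
    have := ENNReal.toReal_mono hg'.ne hx
    simpa using this
  have hC0 : 0 ≤ C := (abs_nonneg _).trans (hC 0)
  -- The summands `G`, `C ^ 2`, `C` compensate `g`, `s ^ 2`, `b s`, leaving the required `+ 1` in
  -- the lower bound for the weight.
  set k := 1 + G + C ^ 2 + C with hk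
  set M₁ : ℝ → ℝ := fun x => (p + B * x) ^ 2 + max (v₁ x) 0 - g x - (s x ^ 2 + b x * s x) + k
    with hM₁
  have hq : IsLocL2 fun x => (p + B * x) ^ 2 := .of_continuous (by fun_prop)
  have hsb : IsLocL2 fun x => s x ^ 2 + b x * s x :=
    .of_continuous ((hs.continuous.pow 2).add (hb.mul hs.continuous))
  have hM₁l : IsLocL2 M₁ :=
    (((hq.add h₁.posPart_locL2).sub (.of_memLp_top hg)).sub hsb).add
      (.of_continuous continuous_const)
  have hd : IsLocL2 fun x => v₂ x - v₁ x := h₂.isLocL2.sub h₁.isLocL2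
  have hM₂l : IsLocL2 fun x => M₁ x + (v₂ x - v₁ x) := hM₁l.add hd
  obtain ⟨m₁, hm₁, hm₁l, hm₁e⟩ := exists_measurable_ge (l := fun x => (p + B * x) ^ 2 + 1)
    hM₁l.aestronglyMeasurable (by fun_prop) (by
      filter_upwards [hG] with x hx
      have h1 := (abs_le.1 hx).2
      have h2 : s x ^ 2 ≤ C ^ 2 := by
        rw [← sq_abs]
        exact pow_le_pow_left₀ (abs_nonneg _) (hC x) 2
      have h3 : b x * s x ≤ C := by
        refine (le_abs_self _).trans ?_
        rw [abs_mul]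
        exact (mul_le_of_le_one_left (abs_nonneg _) (hb1 x)).trans (hC x)
      have h4 := le_max_right (v₁ x) 0
      simp only [hM₁, hk]
      linarith)
  -- All of `v₂ - v₁ ≥ 0` goes into the weight, so `v₂` reuses the decomposition of `v₁`. The lower
  -- bound `m₁` makes the order hold pointwise.
  obtain ⟨m₂, hm₂, hm₂l, hm₂e⟩ := exists_measurable_ge (l := m₁) hM₂l.aestronglyMeasurable hm₁ (by
    filter_upwards [hm₁e, h] with x h1 h2
    rw [h1]
    linarith)
  have hrep : ∀ᵐ x, (p + B * x) ^ 2 + v₁ x = M₁ x - k + s x ^ 2 - (f x - b x * s x) := by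
    filter_upwards [hfg] with x hx
    simp only [hM₁]
    rw [Pi.add_apply] at hx
    have hv : v₁ x = max (v₁ x) 0 - max (-v₁ x) 0 := by
      rcases le_total (v₁ x) 0 with h0 | h0
      · rw [max_eq_right h0, max_eq_left (by linarith)]; ring
      · rw [max_eq_left h0, max_eq_right (by linarith)]; ring
    rw [hx] at hv
    linarith
  refine ⟨⟨s, _, m₁, C, hs, hC, hm₁, hm₁l, hM₁l.locallyIntegrable.congr_ae hm₁e.symm⟩,
    ⟨s, _, m₂, C, hs, hC, hm₂, fun x => (hm₁l x).trans (hm₂l x),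
      hM₂l.locallyIntegrable.congr_ae hm₂e.symm⟩, k,
    ⟨h₁.isLocL2, ?_⟩, ⟨h₂.isLocL2, ?_⟩, rfl, hm₂l⟩
  · filter_upwards [hrep, hm₁e] with x h1 h2
    rw [h1, h2]
  · filter_upwards [hrep, hm₂e] with x h1 h2
    rw [h2]
    linarith

variable {B : ℝ}

lemma Admissible.finite_eigenvalues (hB : 0 < B) (h : Admissible v) (p a : ℝ) :
    (eigenvalues B p v ∩ Set.Iic a).Finite := by
  obtain ⟨c, _, k, hc, -⟩ := exists_represents B p h h (Eventually.of_forall fun _ => le_rfl)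
  exact hc.finite_eigenvalues hB a

lemma Admissible.infinite_eigenvalues (hB : 0 < B) (h : Admissible v) (p : ℝ) :
    (eigenvalues B p v).Infinite := by
  obtain ⟨c, _, k, hc, -⟩ := exists_represents B p h h (Eventually.of_forall fun _ => le_rfl)
  exact hc.infinite_eigenvalues hB

lemma eps_eq_enumBelow (B p : ℝ) (v : ℝ → ℝ) : eps B p v = enumBelow (eigenvalues B p v) := rfl

lemma eps_le_eps (hB : 0 < B) (h₁ : Admissible v₁) (h₂ : Admissible v₂) (h : ∀ᵐ x, v₁ x ≤ v₂ x)
    (p : ℝ) (n : ℕ) : eps B p v₁ n ≤ eps B p v₂ n := by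
  obtain ⟨c₁, c₂, k, hc₁, hc₂, hs, hm⟩ := exists_represents B p h₁ h₂ h
  rw [eps_eq_enumBelow, eps_eq_enumBelow]
  exact enumBelow_le_enumBelow (h₁.finite_eigenvalues hB p) (h₁.infinite_eigenvalues hB p)
    (h₂.finite_eigenvalues hB p) (h₂.infinite_eigenvalues hB p)
    (FormCoeff.ncard_eigenvalues_le hB hc₁ hc₂ hs hm) n

end Admissible

/-! ### The harmonic oscillator and its ladder operators. -/

section Oscillator

lemma admissible_zero : Admissible fun _ => 0 where
  posPart_locL2 K _ := by simp
  negPart_L2_add_Linfty := ⟨0, 0, MemLp.zero, MemLp.zero, by simp; rfl⟩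

/-- The form coefficients of the harmonic oscillator. -/
def oscillatorCoeff (B p : ℝ) : FormCoeff B p where
  s _ := 0
  s' _ := 0
  m x := (p + B * x) ^ 2 + 1
  C := 0
  isPrim_s := IsPrim.const 0
  abs_s_le _ := by simp
  measurable_m := by fun_prop
  le_m _ := le_rfl
  locallyIntegrable_m := by
    have : Continuous fun x : ℝ => (p + B * x) ^ 2 + 1 := by fun_prop
    exact this.locallyIntegrable

lemma oscillatorCoeff_represents (B p : ℝ) : (oscillatorCoeff B p).Represents 1 fun _ => 0 where
  isLocL2 := .of_continuous continuous_const
  eq := Eventually.of_forall fun x => by simp [oscillatorCoeff]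

/-- Classical solutions of `-u'' + (p + B x)² u = E u`, with `z = u'`. -/
structure IsOscillatorSol (B p E : ℝ) (u z : ℝ → ℝ) : Prop where
  hasDerivAt_fst : ∀ x, HasDerivAt u (z x) x
  hasDerivAt_snd : ∀ x, HasDerivAt z (((p + B * x) ^ 2 - E) * u x) x

variable {B p E : ℝ} {u z : ℝ → ℝ}

namespace IsOscillatorSol

lemma continuous_fst (h : IsOscillatorSol B p E u z) : Continuous u :=
  continuous_iff_continuousAt.2 fun x => (h.hasDerivAt_fst x).continuousAt

lemma continuous_snd (h : IsOscillatorSol B p E u z) : Continuous z :=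
  continuous_iff_continuousAt.2 fun x => (h.hasDerivAt_snd x).continuousAt

lemma isSol (h : IsOscillatorSol B p E u z) : (oscillatorCoeff B p).IsSol (E + 1) u z where
  isPrim_fst := (IsPrim.of_hasDerivAt h.hasDerivAt_fst h.continuous_snd).congr (fun _ => rfl)
    (Eventually.of_forall fun x => by simp [oscillatorCoeff])
  isPrim_snd := (IsPrim.of_hasDerivAt h.hasDerivAt_snd (by
      have := h.continuous_fst
      fun_prop)).congr (fun _ => rfl)
    (Eventually.of_forall fun x => by simp [oscillatorCoeff])

lemma memLp_snd (h : IsOscillatorSol B p E u z) (hu : MemLp u 2 volume) : MemLp z 2 volume :=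
  (h.isSol.hasEnergy hu).memLp_deriv

lemma memLp_mul (h : IsOscillatorSol B p E u z) (hu : MemLp u 2 volume) :
    MemLp (fun x => (p + B * x) * u x) 2 volume := by
  have hc : Continuous fun x => (p + B * x) * u x := by
    have := h.continuous_fst
    fun_prop
  refine (h.isSol.hasEnergy hu).memLp_weight.of_le hc.aestronglyMeasurable
    (Eventually.of_forall fun x => ?_)
  rw [norm_mul, norm_mul, Real.norm_of_nonneg (Real.sqrt_nonneg _), Real.norm_eq_abs]
  refine mul_le_mul_of_nonneg_right (Real.le_sqrt_of_sq_le ?_) (norm_nonneg _)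
  rw [sq_abs]
  exact (oscillatorCoeff B p).le_m x |>.trans' (by linarith)

lemma hasDerivAt_mul (h : IsOscillatorSol B p E u z) (x : ℝ) :
    HasDerivAt (fun x => (p + B * x) * u x) (B * u x + (p + B * x) * z x) x := by
  have h1 : HasDerivAt (fun x : ℝ => p + B * x) B x := by
    simpa using ((hasDerivAt_id x).const_mul B).const_add p
  exact h1.mul (h.hasDerivAt_fst x)

lemma hasDerivAt_mul_snd (h : IsOscillatorSol B p E u z) (x : ℝ) :
    HasDerivAt (fun x => (p + B * x) * z x)
      (B * z x + (p + B * x) * (((p + B * x) ^ 2 - E) * u x)) x := by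
  have h1 : HasDerivAt (fun x : ℝ => p + B * x) B x := by
    simpa using ((hasDerivAt_id x).const_mul B).const_add p
  exact h1.mul (h.hasDerivAt_snd x)

lemma hasDerivAt_mul_mul (h : IsOscillatorSol B p E u z) (x : ℝ) :
    HasDerivAt (fun x => (p + B * x) * ((p + B * x) * u x))
      (B * ((p + B * x) * u x) + (p + B * x) * (B * u x + (p + B * x) * z x)) x := by
  have h1 : HasDerivAt (fun x : ℝ => p + B * x) B x := by
    simpa using ((hasDerivAt_id x).const_mul B).const_add p
  exact h1.mul (h.hasDerivAt_mul x)

/-- The annihilation operator. -/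
lemma lower (h : IsOscillatorSol B p E u z) : IsOscillatorSol B p (E - 2 * B)
    (fun x => z x + (p + B * x) * u x)
    (fun x => (p + B * x) * ((p + B * x) * u x) + (B - E) * u x + (p + B * x) * z x) where
  hasDerivAt_fst x := by
    refine ((h.hasDerivAt_snd x).add (h.hasDerivAt_mul x)).congr_deriv ?_
    ring
  hasDerivAt_snd x := by
    refine (((h.hasDerivAt_mul_mul x).add ((h.hasDerivAt_fst x).const_mul (B - E))).add
      (h.hasDerivAt_mul_snd x)).congr_deriv ?_
    ring

/-- The creation operator. -/
lemma raise (h : IsOscillatorSol B p E u z) : IsOscillatorSol B p (E + 2 * B)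
    (fun x => (p + B * x) * u x - z x)
    (fun x => (p + B * x) * z x - ((p + B * x) * ((p + B * x) * u x) - (B + E) * u x)) where
  hasDerivAt_fst x := by
    refine ((h.hasDerivAt_mul x).sub (h.hasDerivAt_snd x)).congr_deriv ?_
    ring
  hasDerivAt_snd x := by
    refine ((h.hasDerivAt_mul_snd x).sub
      ((h.hasDerivAt_mul_mul x).sub ((h.hasDerivAt_fst x).const_mul (B + E)))).congr_deriv ?_
    ring

end IsOscillatorSol

lemma mem_eigenvalues_zero_iff : E ∈ eigenvalues B p (fun _ => 0) ↔
    ∃ u z, IsOscillatorSol B p E u z ∧ MemLp u 2 volume ∧ ∃ t, u t ≠ 0 := by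
  constructor
  · intro hE
    obtain ⟨u, z, h, hu, hne⟩ := FormCoeff.mem_formSpectrum_iff.1
      ((oscillatorCoeff_represents B p).mem_formSpectrum hE)
    have huc := h.isPrim_fst.continuous
    have hzc := h.isPrim_snd.continuous
    have h1 : IsPrim u z := h.isPrim_fst.congr (fun _ => rfl)
      (Eventually.of_forall fun x => by simp [oscillatorCoeff])
    have h2 : IsPrim z (fun x => ((p + B * x) ^ 2 - E) * u x) :=
      h.isPrim_snd.congr (fun _ => rfl) (Eventually.of_forall fun x => by simp [oscillatorCoeff])
    exact ⟨u, z, ⟨h1.hasDerivAt hzc, h2.hasDerivAt (by fun_prop)⟩, hu, hne⟩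
  · rintro ⟨u, z, h, hu, hne⟩
    exact (oscillatorCoeff_represents B p).mem_eigenvalues
      (FormCoeff.mem_formSpectrum_iff.2 ⟨u, z, h.isSol, hu, hne⟩)

/-- The embedding is a contraction, so the shifted form eigenvalue `E + 1` is at least 1. -/
lemma nonneg_of_mem_eigenvalues_zero (hE : E ∈ eigenvalues B p (fun _ => 0)) : 0 ≤ E := by
  obtain ⟨x, hx⟩ := (oscillatorCoeff_represents B p).mem_formSpectrum hE
  have h1 := hx.norm_sq
  have h2 : ‖(oscillatorCoeff B p).J x‖ ≤ ‖x‖ := (oscillatorCoeff B p).norm_proj_le x.1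
  have h3 : 0 < ‖x‖ := norm_pos_iff.2 hx.1
  have h4 := pow_le_pow_left₀ (norm_nonneg _) h2 2
  have h5 := hx.pos
  by_contra hcon
  push Not at hcon
  nlinarith [sq_nonneg ‖(oscillatorCoeff B p).J x‖, pow_pos h3 2]

/-- Lowering annihilates only at `E = B`: if `z + (p + B x) u` vanishes identically, so does its
derivative, which leaves `(B - E) u = 0`. -/
lemma sub_mem_eigenvalues_zero (hE : E ∈ eigenvalues B p (fun _ => 0)) (hne : E ≠ B) :
    E - 2 * B ∈ eigenvalues B p (fun _ => 0) := by
  obtain ⟨u, z, h, hu, t, ht⟩ := mem_eigenvalues_zero_iff.1 hE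
  refine mem_eigenvalues_zero_iff.2 ⟨_, _, h.lower, (h.memLp_snd hu).add (h.memLp_mul hu), ?_⟩
  by_contra hcon
  push Not at hcon
  have h1 := h.lower.hasDerivAt_fst t
  simp only [hcon] at h1
  have h2 := h1.unique (hasDerivAt_const t (0 : ℝ))
  have h3 := hcon t
  have h4 : (B - E) * u t = 0 := by linear_combination h2 - (p + B * t) * h3
  exact (mul_ne_zero (sub_ne_zero.2 hne.symm) ht) h4

/-- Raising never annihilates: that would give `(B + E) u = 0`, while `B + E > 0`. -/
lemma add_mem_eigenvalues_zero (hB : 0 < B) (hE : E ∈ eigenvalues B p (fun _ => 0)) :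
    E + 2 * B ∈ eigenvalues B p (fun _ => 0) := by
  have hE0 := nonneg_of_mem_eigenvalues_zero hE
  obtain ⟨u, z, h, hu, t, ht⟩ := mem_eigenvalues_zero_iff.1 hE
  refine mem_eigenvalues_zero_iff.2 ⟨_, _, h.raise, (h.memLp_mul hu).sub (h.memLp_snd hu), ?_⟩
  by_contra hcon
  push Not at hcon
  have h1 := h.raise.hasDerivAt_fst t
  simp only [hcon] at h1
  have h2 := h1.unique (hasDerivAt_const t (0 : ℝ))
  have h3 := hcon t
  have h4 : (B + E) * u t = 0 := by linear_combination h2 + (p + B * t) * h3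
  exact (mul_ne_zero (by linarith) ht) h4

/-- The eigenvalues of the harmonic oscillator. -/
lemma eigenvalues_zero (hB : 0 < B) (p : ℝ) :
    eigenvalues B p (fun _ => 0) = Set.range fun n : ℕ => B * (2 * (n : ℝ) + 1) := by
  set S := eigenvalues B p (fun _ => 0) with hS
  -- Lowering repeatedly must stop at `B`, as otherwise it would produce a negative eigenvalue.
  have hdesc : ∀ n : ℕ, ∀ E ∈ S, E ≤ 2 * B * n → ∃ k : ℕ, E = B * (2 * (k : ℝ) + 1) := by
    intro n
    induction n with
    | zero =>
      intro E hE hle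
      by_cases hEB : E = B
      · exact ⟨0, by rw [hEB]; simp⟩
      · have := nonneg_of_mem_eigenvalues_zero (sub_mem_eigenvalues_zero hE hEB)
        rw [Nat.cast_zero, mul_zero] at hle
        linarith
    | succ n ih =>
      intro E hE hle
      by_cases hEB : E = B
      · exact ⟨0, by rw [hEB]; simp⟩
      · push_cast at hle
        obtain ⟨k, hk⟩ := ih _ (sub_mem_eigenvalues_zero hE hEB) (by linarith)
        exact ⟨k + 1, by push_cast; linarith⟩
  have hsub : ∀ E ∈ S, ∃ k : ℕ, E = B * (2 * (k : ℝ) + 1) := fun E hE => by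
    obtain ⟨n, hn⟩ := exists_nat_ge (E / (2 * B))
    exact hdesc n E hE (by rwa [div_le_iff₀' (by positivity)] at hn)
  have hbase : ∀ k : ℕ, B * (2 * (k : ℝ) + 1) ∈ S → B ∈ S := by
    intro k
    induction k with
    | zero => intro h; simpa using h
    | succ k ih =>
      intro h
      refine ih ?_
      have h1 := sub_mem_eigenvalues_zero h (by
        have : (0 : ℝ) ≤ k := Nat.cast_nonneg k
        push_cast
        nlinarith)
      convert h1 using 1
      push_cast
      ring
  -- No explicit Gaussian is needed: some eigenvalue exists by the abstract theory, and lowering it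
  -- arrives at `B`.
  have hBS : B ∈ S := by
    obtain ⟨E, hE⟩ := (admissible_zero.infinite_eigenvalues hB p).nonempty
    obtain ⟨k, rfl⟩ := hsub E hE
    exact hbase k hE
  refine Set.Subset.antisymm (fun E hE => ?_) ?_
  · obtain ⟨k, hk⟩ := hsub E hE
    exact ⟨k, hk.symm⟩
  · rintro _ ⟨n, rfl⟩
    induction n with
    | zero => simpa using hBS
    | succ n ih =>
      have h1 := add_mem_eigenvalues_zero hB ih
      convert h1 using 1
      push_cast
      ring

/-- The Landau levels. -/
lemma eps_zero (hB : 0 < B) (p : ℝ) (n : ℕ) :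
    eps B p (fun _ => 0) n = B * (2 * (n : ℝ) + 1) := by
  have h1 : StrictMono (enumBelow (eigenvalues B p (fun _ => 0))) :=
    strictMono_enumBelow (admissible_zero.finite_eigenvalues hB p)
      (admissible_zero.infinite_eigenvalues hB p)
  have h2 : StrictMono fun n : ℕ => B * (2 * (n : ℝ) + 1) := fun a b hab => by
    have : (a : ℝ) < b := by exact_mod_cast hab
    simp only
    nlinarith
  have h3 := (h1.range_inj h2).1 (by
    rw [range_enumBelow (admissible_zero.finite_eigenvalues hB p)
      (admissible_zero.infinite_eigenvalues hB p), eigenvalues_zero hB])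
  exact congrFun h3 n

end Oscillator

end LandauPotential

end

theorem lemma4p2 (B : ℝ) (hB : 0 < B) :
    -- the eigenvalues of `h_v(p)` are exactly `ε_0(p, v) < ε_1(p, v) < …`
    (∀ v : ℝ → ℝ, LandauPotential.Admissible v → ∀ p : ℝ,
      StrictMono (LandauPotential.eps B p v) ∧
        Set.range (LandauPotential.eps B p v) = LandauPotential.eigenvalues B p v) ∧
    -- monotonicity in the potential
    (∀ v₁ v₂ : ℝ → ℝ, LandauPotential.Admissible v₁ → LandauPotential.Admissible v₂ →
      (∀ᵐ x : ℝ, v₁ x ≤ v₂ x) →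
      ∀ (p : ℝ) (n : ℕ), LandauPotential.eps B p v₁ n ≤ LandauPotential.eps B p v₂ n) ∧
    -- sign-definite potentials
    (∀ v : ℝ → ℝ, LandauPotential.Admissible v → (∀ᵐ x : ℝ, 0 ≤ v x) →
      ∀ (p : ℝ) (n : ℕ), B * (2 * (n : ℝ) + 1) ≤ LandauPotential.eps B p v n) ∧
    (∀ v : ℝ → ℝ, LandauPotential.Admissible v → (∀ᵐ x : ℝ, v x ≤ 0) →
      ∀ (p : ℝ) (n : ℕ), LandauPotential.eps B p v n ≤ B * (2 * (n : ℝ) + 1)) := by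
  refine ⟨fun v hv p => ⟨?_, ?_⟩, fun v₁ v₂ h₁ h₂ h p n => LandauPotential.eps_le_eps hB h₁ h₂ h p n,
    fun v hv h p n => ?_, fun v hv h p n => ?_⟩
  · exact LandauPotential.strictMono_enumBelow (hv.finite_eigenvalues hB p)
      (hv.infinite_eigenvalues hB p)
  · exact LandauPotential.range_enumBelow (hv.finite_eigenvalues hB p)
      (hv.infinite_eigenvalues hB p)
  · rw [← LandauPotential.eps_zero hB p n]
    exact LandauPotential.eps_le_eps hB LandauPotential.admissible_zero hv h p n
  · rw [← LandauPotential.eps_zero hB p n]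
    exact LandauPotential.eps_le_eps hB hv LandauPotential.admissible_zero h p n
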